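/- An instance of Weighted $\mathcal{C}$-Coalition Formation consists of a finite simple undirected graph $G=(V,E)$ on $n$ vertices, an edge-weight function $w:E\to\mathbb{N}$, and a capacity $\mathcal{C}\in\mathbb{N}$. A $\mathcal{C}$-partition is a partition $\mathcal{P}=\{C_1,\dots,C_p\}$ of $V$ with $|C_i|\le\mathcal{C}$ for every $i$; its value is $v(\mathcal{P})=\sum_{i=1}^{p}\sum_{e\in E(G[C_i])}w(e)$. The task is to compute an optimal $\mathcal{C}$-partition, that is, a $\mathcal{C}$-partition of maximum value (whenever some $\mathcal{C}$-partition exists, which is always the case for $\mathcal{C}\ge 1$). Let $\mathrm{vc}$ denote the vertex cover number of $G$, the minimum size of a set $U\subseteq V$ that meets every edge; it is not given with the input. Theorem. Weighted $\mathcal{C}$-Coalition Formation can be solved in time $\mathrm{vc}^{O(\mathrm{vc})}\cdot n^{O(1)}$. Precisely: there are one deterministic random access machine program (whose unit-cost operations on natural numbers are addition, truncated subtraction, comparison, and indexed reading and writing of memory) and one constant $c$ such that, on every instance, given by $n$, $\mathcal{C}$, the adjacency matrix and the weight matrix, the program halts after at most $c\cdot \mathrm{vc}^{c\cdot\mathrm{vc}}\cdot(n+1)^{c}$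 steps (with $0^0=1$), and, if the instance has a $\mathcal{C}$-partition, it outputs an optimal one. -/

import Mathlib

namespace CoalitionFormation

/-! ### The problem -/

/-- An instance of Weighted `𝒞`-Coalition Formation: a graph `G` on the `n` vertices
`0, …, n - 1`, an edge-weight function `w : E(G) → ℕ`, and a capacity. -/
structure Instance where
  /-- the number of vertices -/
  n : ℕ
  /-- the input graph -/
  G : SimpleGraph (Fin n)
  /-- the edge weights -/
  w : G.edgeSet → ℕ
  /-- the maximum size allowed for a coalition -/
  capacity : ℕ

namespace Instance

variable (I : Instance)

/-- Partitions of the vertex set into nonempty, pairwise disjoint coalitions. -/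
abbrev VertexPartition : Type :=
  Finpartition (Finset.univ : Finset (Fin I.n))

open Classical in
/-- The edges of the induced subgraph `G[S]`: the edges of `G` with both ends in `S`. -/
noncomputable def edgesIn (S : Finset (Fin I.n)) : Finset I.G.edgeSet :=
  Finset.univ.filter fun e => ∀ v ∈ (e : Sym2 (Fin I.n)), v ∈ S

/-- The value of a partition: the total weight of the edges inside its coalitions. -/
noncomputable def value (P : I.VertexPartition) : ℕ :=
  ∑ S ∈ P.parts, ∑ e ∈ I.edgesIn S, I.w e

/-- A `𝒞`-partition: every coalition has at most `𝒞` members. -/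
def IsCapacityPartition (P : I.VertexPartition) : Prop :=
  ∀ S ∈ P.parts, S.card ≤ I.capacity

/-- An optimal `𝒞`-partition: a `𝒞`-partition of maximum value. -/
def IsOptimal (P : I.VertexPartition) : Prop :=
  I.IsCapacityPartition P ∧
    ∀ Q : I.VertexPartition, I.IsCapacityPartition Q → I.value Q ≤ I.value P

/-- The vertex cover number of the input graph, as a natural number (it is finite, since the
graph is finite). -/
noncomputable def vc : ℕ :=
  I.G.vertexCoverNum.toNat

end Instance

/-! ### The machine model

A random access machine that stores natural numbers in registers and in arrays. A program is a
fixed piece of text, so it uses finitely many registers and arrays. It is structured (sequencing,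
branching, loops). The arithmetic operations are addition and truncated subtraction only, and
every evaluation of a node of an expression or test, every store, and every `skip` costs one step.
There is no multiplication, so `t` steps on inputs of at most `b` bits produce only numbers of
`O(b + t)` bits, and the model is polynomially equivalent to Turing machines. -/

/-- The memory: the contents of the registers, and of the arrays (array number, then cell). -/
structure Store where
  /-- contents of the registers -/
  reg : ℕ → ℕ
  /-- contents of the arrays -/
  arr : ℕ → ℕ → ℕ

/-- Arithmetic expressions. -/
inductive Expr : Type
  /-- a constant -/
  | const (k : ℕ)
  /-- the content of register `x` -/
  | reg (x : ℕ)
  /-- the content of the cell of array `a` with the computed address -/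
  | read (a : ℕ) (addr : Expr)
  /-- addition -/
  | add (e₁ e₂ : Expr)
  /-- truncated subtraction -/
  | sub (e₁ e₂ : Expr)

/-- The value of an expression. -/
def Expr.eval (s : Store) : Expr → ℕ
  | .const k => k
  | .reg x => s.reg x
  | .read a addr => s.arr a (addr.eval s)
  | .add e₁ e₂ => e₁.eval s + e₂.eval s
  | .sub e₁ e₂ => e₁.eval s - e₂.eval s

/-- The number of steps needed to evaluate an expression: one per node. -/
def Expr.cost : Expr → ℕ
  | .const _ => 1
  | .reg _ => 1
  | .read _ addr => addr.cost + 1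
  | .add e₁ e₂ => e₁.cost + e₂.cost + 1
  | .sub e₁ e₂ => e₁.cost + e₂.cost + 1

/-- Boolean tests. -/
inductive Test : Type
  /-- `e₁ < e₂` -/
  | lt (e₁ e₂ : Expr)
  /-- `e₁ = e₂` -/
  | eq (e₁ e₂ : Expr)
  /-- negation -/
  | not (b : Test)
  /-- conjunction -/
  | and (b₁ b₂ : Test)

/-- The truth value of a test. -/
def Test.eval (s : Store) : Test → Bool
  | .lt e₁ e₂ => decide (e₁.eval s < e₂.eval s)
  | .eq e₁ e₂ => decide (e₁.eval s = e₂.eval s)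
  | .not b => !(b.eval s)
  | .and b₁ b₂ => b₁.eval s && b₂.eval s

/-- The number of steps needed to evaluate a test: one per node. -/
def Test.cost : Test → ℕ
  | .lt e₁ e₂ => e₁.cost + e₂.cost + 1
  | .eq e₁ e₂ => e₁.cost + e₂.cost + 1
  | .not b => b.cost + 1
  | .and b₁ b₂ => b₁.cost + b₂.cost + 1

/-- Programs. -/
inductive Program : Type
  /-- do nothing -/
  | skip
  /-- put the value of `e` into register `x` -/
  | assign (x : ℕ) (e : Expr)
  /-- put the value of `e` into the cell of array `a` with the computed address -/
  | write (a : ℕ) (addr e : Expr)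
  /-- run `p`, then `q` -/
  | seq (p q : Program)
  /-- run `p` if `b` holds, otherwise `q` -/
  | branch (b : Test) (p q : Program)
  /-- as long as `b` holds, run `p` -/
  | loop (b : Test) (p : Program)

/-- `Runs p s t s'`: started in memory `s`, the program `p` halts after exactly `t` steps, with
memory `s'`. -/
inductive Runs : Program → Store → ℕ → Store → Prop
  | skip (s : Store) : Runs .skip s 1 s
  | assign (x : ℕ) (e : Expr) (s : Store) :
      Runs (.assign x e) s (e.cost + 1)
        ⟨Function.update s.reg x (e.eval s), s.arr⟩
  | write (a : ℕ) (addr e : Expr) (s : Store) :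
      Runs (.write a addr e) s (addr.cost + e.cost + 1)
        ⟨s.reg, Function.update s.arr a
          (Function.update (s.arr a) (addr.eval s) (e.eval s))⟩
  | seq {p q : Program} {s s₁ s₂ : Store} {t₁ t₂ : ℕ} :
      Runs p s t₁ s₁ → Runs q s₁ t₂ s₂ → Runs (.seq p q) s (t₁ + t₂) s₂
  | branch_true {b : Test} {p q : Program} {s s' : Store} {t : ℕ} :
      b.eval s = true → Runs p s t s' → Runs (.branch b p q) s (b.cost + t) s'
  | branch_false {b : Test} {p q : Program} {s s' : Store} {t : ℕ} :
      b.eval s = false → Runs q s t s' → Runs (.branch b p q) s (b.cost + t) s'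
  | loop_true {b : Test} {p : Program} {s s₁ s₂ : Store} {t₁ t₂ : ℕ} :
      b.eval s = true → Runs p s t₁ s₁ → Runs (.loop b p) s₁ t₂ s₂ →
        Runs (.loop b p) s (b.cost + t₁ + t₂) s₂
  | loop_false {b : Test} {p : Program} {s : Store} :
      b.eval s = false → Runs (.loop b p) s b.cost s

/-- The machine is deterministic: number of steps and final memory are determined. -/
theorem Runs.deterministic {p : Program} {s s₁ s₂ : Store} {t₁ t₂ : ℕ}
    (h₁ : Runs p s t₁ s₁) (h₂ : Runs p s t₂ s₂) : t₁ = t₂ ∧ s₁ = s₂ := by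
  induction h₁ generalizing t₂ s₂ with
  | skip => cases h₂; exact ⟨rfl, rfl⟩
  | assign => cases h₂; exact ⟨rfl, rfl⟩
  | write => cases h₂; exact ⟨rfl, rfl⟩
  | seq _ _ ih ih' =>
    cases h₂ with
    | seq k k' =>
      obtain ⟨rfl, rfl⟩ := ih k
      obtain ⟨rfl, rfl⟩ := ih' k'
      exact ⟨rfl, rfl⟩
  | branch_true hb _ ih =>
    cases h₂ with
    | branch_true _ k => obtain ⟨rfl, rfl⟩ := ih k; exact ⟨rfl, rfl⟩
    | branch_false hb' _ => simp [hb] at hb'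
  | branch_false hb _ ih =>
    cases h₂ with
    | branch_true hb' _ => simp [hb] at hb'
    | branch_false _ k => obtain ⟨rfl, rfl⟩ := ih k; exact ⟨rfl, rfl⟩
  | loop_true hb _ _ ih ih' =>
    cases h₂ with
    | loop_true _ k k' =>
      obtain ⟨rfl, rfl⟩ := ih k
      obtain ⟨rfl, rfl⟩ := ih' k'
      exact ⟨rfl, rfl⟩
    | loop_false hb' => simp [hb] at hb'
  | loop_false hb =>
    cases h₂ with
    | loop_true hb' _ _ => simp [hb] at hb'
    | loop_false _ => exact ⟨rfl, rfl⟩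

/-! ### Input and output -/

namespace Instance

variable (I : Instance)

open Classical in
/-- The entry of the adjacency matrix at `(i, j)`: `1` for an edge, `0` otherwise. -/
noncomputable def adjEntry (i j : Fin I.n) : ℕ :=
  if I.G.Adj i j then 1 else 0

open Classical in
/-- The entry of the weight matrix at `(i, j)`: the weight of the edge `ij`, and `0` if `ij` is
not an edge. -/
noncomputable def weightEntry (i j : Fin I.n) : ℕ :=
  if h : I.G.Adj i j then I.w ⟨s(i, j), h⟩ else 0

/-- A matrix as the content of an array, row by row: the entry at `(i, j)` is in cell `n * i + j`,
and all cells from `n * n` on contain `0`. -/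
def layout {n : ℕ} (M : Fin n → Fin n → ℕ) (k : ℕ) : ℕ :=
  if h : k < n * n then M (Fin.divNat ⟨k, h⟩) (Fin.modNat ⟨k, h⟩) else 0

/-- The initial memory: `n` in register `0`, the capacity in register `1`, the adjacency matrix in
array `0`, the weight matrix in array `1`, and `0` everywhere else. -/
noncomputable def input : Store where
  reg
    | 0 => I.n
    | 1 => I.capacity
    | _ => 0
  arr
    | 0 => layout I.adjEntry
    | 1 => layout I.weightEntry
    | _ => fun _ => 0

/-- The final memory `s` contains the partition `P`: cell `i` of array `2` holds a label of the
coalition of vertex `i`, so that two vertices have equal labels exactly if some coalition of `P`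
contains both. -/
def OutputIs (s : Store) (P : I.VertexPartition) : Prop :=
  ∀ i j : Fin I.n, s.arr 2 i = s.arr 2 j ↔ ∃ S ∈ P.parts, i ∈ S ∧ j ∈ S

end Instance

/-- The program `p` solves Weighted `𝒞`-Coalition Formation within the time bound `T`: on every
instance it halts after at most `T I` steps, and its output is an optimal `𝒞`-partition whenever
the instance has a `𝒞`-partition at all (that is, unless the capacity is `0` and there are
vertices). -/
def SolvesInTime (p : Program) (T : Instance → ℕ) : Prop :=
  ∀ I : Instance, ∃ (t : ℕ) (s : Store), Runs p I.input t s ∧ t ≤ T I ∧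
    ((∃ P : I.VertexPartition, I.IsCapacityPartition P) →
      ∃ P : I.VertexPartition, I.IsOptimal P ∧ I.OutputIs s P)

end CoalitionFormation

namespace CoalitionFormation

/-! ### A language of bounded loops -/

/-! The ends of the edges of a greedily chosen maximal matching form a vertex cover, here called the
marked vertices. Their number `u` is at most `2 * vc`, because every vertex cover contains an end of
each matching edge. A coalition that misses the cover has value `0` and may be split into
singletons, so at most `u` coalitions matter. A partition is therefore recorded as a labelling by
`0, …, u`: labels below `u` name coalitions, which must respect the capacity, and label `u` means
"alone" and has no capacity limit.

The program tries all base-`(u + 1)` digit sequences as labels of the marked vertices. Once these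
labels are fixed, the unmarked vertices no longer interact through weights, since they are
independent: by `Data.val_eq` the value is a constant plus a sum of one contribution per unmarked
vertex. What remains is an assignment problem with capacities.

This problem is solved by inserting the unmarked vertices one at a time. Let `A` be optimal while
`x` stays in class `u`, and let `B` be optimal once `x` may move too, as close to `A` as possible.
Following the elements displaced by `x` from class to class, one reaches a class with free room or
closes a cycle. A cycle can be undone in `B` without loss, contradicting the choice of `B`. A path
into a class with room, applied to `A`, already gives the optimum, and it takes at most one element
out of each class. This is `exists_optimal_move`.

Hence it suffices to guess, for each of the `u + 1` classes, the class its departing element goes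
to. Given that guess, the element to move is the one with the largest change of contribution
(`Data.victim_max`), and exchanging it for the element on the path changes no class sizes. So each
insertion tries `(u + 1) ^ (u + 1)` digit sequences; `Data.OptAt.exists_shift` shows that one of
them restores optimality.

`Describes.exists_start` and `Describes.exists_optimal` translate between partitions and labellings.
On the machine side, programs are written with counting loops only, so their effect is a total
function `Code.eval`, reasoned about with `Code.rep_inv`. By `Code.runs` and `Code.bound_le` the
running time is polynomial in a common bound for the loop lengths, here `n + (u + 1) ^ (u + 1)`, and
`codes_le` turns this into the claimed bound. -/

/-- Set a register. -/
def Store.setReg (s : Store) (x v : ℕ) : Store :=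
  ⟨Function.update s.reg x v, s.arr⟩

/-- Set a cell of an array. -/
def Store.setArr (s : Store) (a i v : ℕ) : Store :=
  ⟨s.reg, Function.update s.arr a (Function.update (s.arr a) i v)⟩

namespace Store

variable (s : Store) (x y v a i j : ℕ)

@[simp] theorem setReg_arr : (s.setReg x v).arr = s.arr := rfl

@[simp] theorem setArr_reg : (s.setArr a i v).reg = s.reg := rfl

theorem setReg_reg : (s.setReg x v).reg y = if y = x then v else s.reg y := by
  simp [setReg, Function.update_apply]

theorem setArr_arr (a' : ℕ) : (s.setArr a i v).arr a' j =
    if a' = a ∧ j = i then v else s.arr a' j := by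
  by_cases h : a' = a
  · subst h; simp [setArr, Function.update_apply]
  · simp [setArr, h]

@[simp] theorem setReg_same : (s.setReg x v).reg x = v := by simp [setReg_reg]

theorem setArr_arr_ne {a' : ℕ} (h : a' ≠ a) : (s.setArr a i v).arr a' = s.arr a' := by
  simp [setArr, h]

end Store

/-- Programs in which every loop is a counting loop. -/
inductive Code : Type
  /-- do nothing -/
  | skip
  /-- assignment to a register -/
  | set (x : ℕ) (e : Expr)
  /-- assignment to a cell of an array -/
  | put (a : ℕ) (addr e : Expr)
  /-- sequential composition -/
  | seq (p q : Code)
  /-- conditional -/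
  | ite (b : Test) (p q : Code)
  /-- run `p` for every value of register `x` below the content of register `b` -/
  | rep (x b : ℕ) (p : Code)

/-- Iterate `f`, counting the iterations in register `x`. -/
def iter (f : Store → Store) (x : ℕ) (s : Store) : ℕ → Store
  | 0 => s.setReg x 0
  | i + 1 => (f (iter f x s i)).setReg x (i + 1)

namespace Code

/-- The effect of a program on the memory. -/
def eval : Code → Store → Store
  | skip, s => s
  | set x e, s => s.setReg x (e.eval s)
  | put a addr e, s => s.setArr a (addr.eval s) (e.eval s)
  | seq p q, s => q.eval (p.eval s)
  | ite b p q, s => if b.eval s = true then p.eval s else q.eval s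
  | rep x b p, s => iter p.eval x s (s.reg b)

/-- The program of the machine. -/
def toProgram : Code → Program
  | skip => .skip
  | set x e => .assign x e
  | put a addr e => .write a addr e
  | seq p q => .seq p.toProgram q.toProgram
  | ite b p q => .branch b p.toProgram q.toProgram
  | rep x b p => .seq (.assign x (.const 0))
      (.loop (.lt (.reg x) (.reg b)) (.seq p.toProgram (.assign x (.add (.reg x) (.const 1)))))

/-- The registers a program may write. -/
def regs : Code → List ℕ
  | skip => []
  | set x _ => [x]
  | put _ _ _ => []
  | seq p q => p.regs ++ q.regs
  | ite _ p q => p.regs ++ q.regs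
  | rep x _ p => x :: p.regs

/-- The arrays a program may write. -/
def arrs : Code → List ℕ
  | skip => []
  | set _ _ => []
  | put a _ _ => [a]
  | seq p q => p.arrs ++ q.arrs
  | ite _ p q => p.arrs ++ q.arrs
  | rep _ _ p => p.arrs

/-- All loops are bounded by registers from `B`, no register from `B` is written, and no loop
counter is written by the body of its loop. -/
def safe (B : List ℕ) : Code → Bool
  | skip => true
  | set x _ => !B.contains x
  | put _ _ _ => true
  | seq p q => p.safe B && q.safe B
  | ite _ p q => p.safe B && q.safe B
  | rep x b p => !B.contains x && B.contains b && !p.regs.contains x && p.safe B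

/-- A bound for the number of steps, if all loops run at most `M` times. -/
def bound (M : ℕ) : Code → ℕ
  | skip => 1
  | set _ e => e.cost + 1
  | put _ addr e => addr.cost + e.cost + 1
  | seq p q => p.bound M + q.bound M
  | ite b p q => b.cost + (p.bound M + q.bound M)
  | rep _ _ p => 5 + M * (7 + p.bound M)

variable {p q : Code} {s : Store}

theorem eval_reg {y : ℕ} (h : y ∉ p.regs) : (p.eval s).reg y = s.reg y := by
  induction p generalizing s with
  | skip => rfl
  | set x e => simp [regs] at h; simp [eval, Store.setReg_reg, h]
  | put a addr e => rfl
  | seq p q ihp ihq =>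
    simp [regs] at h
    simp [eval, ihp h.1, ihq h.2]
  | ite b p q ihp ihq =>
    simp [regs] at h
    simp only [eval]; split
    · exact ihp h.1
    · exact ihq h.2
  | rep x b p ih =>
    simp [regs] at h
    simp only [eval]
    induction s.reg b with
    | zero => simp [iter, Store.setReg_reg, h]
    | succ i ihi => simp [iter, Store.setReg_reg, h, ih h.2, ihi]

theorem eval_arr {a : ℕ} (h : a ∉ p.arrs) : (p.eval s).arr a = s.arr a := by
  induction p generalizing s with
  | skip => rfl
  | set x e => rfl
  | put a addr e => simp [arrs] at h; simp [eval, Store.setArr_arr_ne _ _ _ _ h]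
  | seq p q ihp ihq =>
    simp [arrs] at h
    simp [eval, ihp h.1, ihq h.2]
  | ite b p q ihp ihq =>
    simp [arrs] at h
    simp only [eval]; split
    · exact ihp h.1
    · exact ihq h.2
  | rep x b p ih =>
    simp [arrs] at h
    simp only [eval]
    induction s.reg b with
    | zero => simp [iter]
    | succ i ihi => simp [iter, ih h, ihi]

theorem iter_reg {x y : ℕ} (h : y ∉ p.regs) (hx : y ≠ x) (i : ℕ) :
    (iter p.eval x s i).reg y = s.reg y := by
  induction i with
  | zero => simp [iter, Store.setReg_reg, hx]
  | succ i ihi => simp [iter, Store.setReg_reg, hx, eval_reg h, ihi]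

theorem iter_arr {x a : ℕ} (h : a ∉ p.arrs) (i : ℕ) :
    (iter p.eval x s i).arr a = s.arr a := by
  induction i with
  | zero => simp [iter]
  | succ i ihi => simp [iter, eval_arr h, ihi]

theorem iter_counter (f : Store → Store) (x i : ℕ) : (iter f x s i).reg x = i := by
  cases i <;> simp [iter]

/-- The invariant rule for counting loops. -/
theorem rep_inv {x b : ℕ} (Inv : ℕ → Store → Prop) (N : ℕ) (hN : s.reg b = N)
    (h0 : Inv 0 (s.setReg x 0))
    (hs : ∀ i s', i < N → s'.reg x = i → (∀ y, y ∉ (rep x b p).regs → s'.reg y = s.reg y) →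
      (∀ a, a ∉ p.arrs → s'.arr a = s.arr a) → Inv i s' →
      Inv (i + 1) ((p.eval s').setReg x (i + 1))) :
    Inv N ((rep x b p).eval s) := by
  simp only [eval, hN]
  suffices h : ∀ i ≤ N, Inv i (iter p.eval x s i) from h N le_rfl
  intro i
  induction i with
  | zero => intro _; exact h0
  | succ i ih =>
    intro hi
    refine hs i _ hi (iter_counter _ _ _) (fun y hy => ?_) (fun a ha => iter_arr ha i)
      (ih (by omega))
    simp only [regs, List.mem_cons, not_or] at hy
    exact iter_reg hy.2 hy.1 i

theorem not_mem_regs_of_safe {B : List ℕ} (h : p.safe B = true) {y : ℕ} (hy : y ∈ B) :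
    y ∉ p.regs := by
  induction p with
  | skip | put => simp [regs]
  | set x e =>
    simp [safe] at h; simp only [regs, List.mem_singleton]; rintro rfl; exact h hy
  | seq p q ihp ihq | ite b p q ihp ihq =>
    simp [safe] at h; simp [regs, ihp h.1, ihq h.2]
  | rep x b p ih =>
    simp [safe] at h
    simp only [regs, List.mem_cons, not_or]
    exact ⟨by rintro rfl; exact h.1.1.1 hy, ih h.2⟩

/-- A program all of whose loops are bounded by `M` halts within `bound M` steps. -/
theorem runs {B : List ℕ} (hp : p.safe B = true) {M : ℕ} (hM : ∀ y ∈ B, s.reg y ≤ M) :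
    ∃ t ≤ p.bound M, Runs p.toProgram s t (p.eval s) := by
  induction p generalizing s with
  | skip => exact ⟨_, le_rfl, Runs.skip s⟩
  | set x e => exact ⟨_, le_rfl, Runs.assign x e s⟩
  | put a addr e => exact ⟨_, le_rfl, Runs.write a addr e s⟩
  | seq p q ihp ihq =>
    simp only [safe, Bool.and_eq_true] at hp
    obtain ⟨t₁, h₁, r₁⟩ := ihp hp.1 hM
    obtain ⟨t₂, h₂, r₂⟩ := ihq (s := p.eval s) hp.2
      (fun y hy => by rw [eval_reg (not_mem_regs_of_safe hp.1 hy)]; exact hM y hy)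
    exact ⟨_, Nat.add_le_add h₁ h₂, Runs.seq r₁ r₂⟩
  | ite b p q ihp ihq =>
    simp only [safe, Bool.and_eq_true] at hp
    simp only [eval, toProgram, bound]
    by_cases hb : b.eval s = true
    · obtain ⟨t₁, h₁, r₁⟩ := ihp hp.1 hM
      rw [if_pos hb]
      exact ⟨_, by omega, Runs.branch_true hb r₁⟩
    · obtain ⟨t₁, h₁, r₁⟩ := ihq hp.2 hM
      rw [if_neg hb]
      exact ⟨_, by omega, Runs.branch_false (by simpa using hb) r₁⟩
  | rep x b p ih =>
    simp [safe] at hp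
    obtain ⟨⟨⟨hx, hb⟩, hxp⟩, hp⟩ := hp
    have hbx : b ≠ x := by rintro rfl; exact hx hb
    have hbp := not_mem_regs_of_safe hp hb
    -- Induction on the number `k` of rounds still to come; the `3` is the cost of the final failing
    -- test.
    have key : ∀ k i, i + k = s.reg b → ∃ t ≤ 3 + k * (7 + p.bound M),
        Runs (.loop (.lt (.reg x) (.reg b))
          (.seq p.toProgram (.assign x (.add (.reg x) (.const 1)))))
          (iter p.eval x s i) t (iter p.eval x s (s.reg b)) := by
      intro k
      induction k with
      | zero =>
        intro i hi
        have : i = s.reg b := by omega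
        subst this
        refine ⟨_, ?_, Runs.loop_false ?_⟩
        · simp [Test.cost, Expr.cost]
        · simp [Test.eval, Expr.eval, iter_counter, iter_reg hbp hbx]
      | succ k ihk =>
        intro i hi
        obtain ⟨t₁, h₁, r₁⟩ := ih (s := iter p.eval x s i) hp (fun y hy => by
          rw [iter_reg (not_mem_regs_of_safe hp hy) (by rintro rfl; exact hx hy)]
          exact hM y hy)
        obtain ⟨t₂, h₂, r₂⟩ := ihk (i + 1) (by omega)
        have r₃ := Runs.assign x (.add (.reg x) (.const 1)) (p.eval (iter p.eval x s i))
        -- `iter` resets the counter to `i + 1`, while the machine increments it. The two agree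
        -- because the body does not write `x`.
        have e : (⟨Function.update (p.eval (iter p.eval x s i)).reg x
            ((Expr.add (.reg x) (.const 1)).eval (p.eval (iter p.eval x s i))),
            (p.eval (iter p.eval x s i)).arr⟩ : Store) = iter p.eval x s (i + 1) := by
          simp [iter, Store.setReg, Expr.eval, eval_reg hxp, iter_counter]
        rw [e] at r₃
        refine ⟨_, ?_, Runs.loop_true ?_ (Runs.seq r₁ r₃) r₂⟩
        · simp only [Test.cost, Expr.cost]
          rw [Nat.succ_mul]; omega
        · simp [Test.eval, Expr.eval, iter_counter, iter_reg hbp hbx]; omega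
    obtain ⟨t, h, r⟩ := key (s.reg b) 0 (by omega)
    refine ⟨_, ?_, Runs.seq (Runs.assign x (.const 0) s) r⟩
    have := Nat.mul_le_mul_right (7 + p.bound M) (hM b hb)
    simp only [Expr.cost, bound]
    omega

/-- Nesting depth is fixed by the program text, and each loop costs one factor `M`. One constant
serves as both factor and exponent, so that constants simply add up under sums. -/
theorem bound_le (p : Code) : ∃ c, ∀ M, p.bound M ≤ c * (M + 1) ^ c := by
  have lift : ∀ {c c' M : ℕ}, c ≤ c' → c * (M + 1) ^ c ≤ c' * (M + 1) ^ c' := fun h =>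
    Nat.mul_le_mul h (Nat.pow_le_pow_right (Nat.succ_pos _) h)
  have const : ∀ k M : ℕ, k ≤ k * (M + 1) ^ k := fun k M =>
    Nat.le_mul_of_pos_right _ (by positivity)
  have sum : ∀ {c c' M : ℕ}, c * (M + 1) ^ c + c' * (M + 1) ^ c' ≤
      (c + c') * (M + 1) ^ (c + c') := fun {c c' M} => by
    rw [Nat.add_mul]
    exact Nat.add_le_add
      (Nat.mul_le_mul_left _ (Nat.pow_le_pow_right (Nat.succ_pos _) (by omega)))
      (Nat.mul_le_mul_left _ (Nat.pow_le_pow_right (Nat.succ_pos _) (by omega)))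
  induction p with
  | skip => exact ⟨1, fun M => const 1 M⟩
  | set x e => exact ⟨_, fun M => const _ M⟩
  | put a addr e => exact ⟨_, fun M => const _ M⟩
  | seq p q ihp ihq =>
    obtain ⟨c, hc⟩ := ihp
    obtain ⟨c', hc'⟩ := ihq
    exact ⟨c + c', fun M => (Nat.add_le_add (hc M) (hc' M)).trans sum⟩
  | ite b p q ihp ihq =>
    obtain ⟨c, hc⟩ := ihp
    obtain ⟨c', hc'⟩ := ihq
    exact ⟨b.cost + (c + c'), fun M => (Nat.add_le_add (const _ M)
      ((Nat.add_le_add (hc M) (hc' M)).trans sum)).trans sum⟩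
  | rep x b p ih =>
    obtain ⟨c, hc⟩ := ih
    refine ⟨5 + (7 + c + 1), fun M => (Nat.add_le_add (const _ M) ?_).trans sum⟩
    calc M * (7 + p.bound M) ≤ (M + 1) * ((7 + c) * (M + 1) ^ (7 + c)) :=
          Nat.mul_le_mul (by omega) ((Nat.add_le_add (const 7 M) (hc M)).trans sum)
      _ = (7 + c) * (M + 1) ^ (7 + c + 1) := by ring
      _ ≤ _ := Nat.mul_le_mul_right _ (by omega)

end Code

end CoalitionFormation

namespace CoalitionFormation

/-! ### The registers and arrays of the program -/

notation "rN" => (0 : ℕ)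
notation "rCap" => (1 : ℕ)
notation "rCover" => (2 : ℕ)
notation "rBase" => (3 : ℕ)
notation "rCodes" => (4 : ℕ)
notation "rOffset" => (5 : ℕ)
notation "rI" => (6 : ℕ)
notation "rJ" => (7 : ℕ)
notation "rAcc" => (8 : ℕ)
notation "rK" => (10 : ℕ)
notation "rX" => (11 : ℕ)
notation "rL" => (12 : ℕ)
notation "rBin" => (13 : ℕ)
notation "rNum" => (14 : ℕ)
notation "rPos" => (15 : ℕ)
notation "rZ" => (16 : ℕ)
notation "rRem" => (17 : ℕ)
notation "rQuot" => (18 : ℕ)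
notation "rCount" => (20 : ℕ)
notation "rVictim" => (21 : ℕ)
notation "rV" => (22 : ℕ)
notation "rW" => (23 : ℕ)
notation "rGain" => (24 : ℕ)
notation "rLoss" => (25 : ℕ)
notation "rLabel" => (26 : ℕ)
notation "rBad" => (29 : ℕ)
notation "rVal" => (30 : ℕ)
notation "rY" => (33 : ℕ)
notation "rStageBest" => (34 : ℕ)
notation "rBest" => (35 : ℕ)
notation "aAdj" => (0 : ℕ)
notation "aWeight" => (1 : ℕ)
notation "aOut" => (2 : ℕ)
notation "aOffset" => (3 : ℕ)
notation "aMark" => (4 : ℕ)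
notation "aDigit" => (5 : ℕ)
notation "aCur" => (6 : ℕ)
notation "aCand" => (7 : ℕ)
notation "aStageBest" => (8 : ℕ)
notation "aBest" => (9 : ℕ)

infixr:60 ";;" => Code.seq

namespace Code

theorem eval_seq (p q : Code) (s : Store) : (p ;; q).eval s = q.eval (p.eval s) := rfl

theorem eval_skip (s : Store) : skip.eval s = s := rfl

theorem eval_set (x : ℕ) (e : Expr) (s : Store) : (set x e).eval s = s.setReg x (e.eval s) := rfl

theorem eval_put (a : ℕ) (i e : Expr) (s : Store) :
    (put a i e).eval s = s.setArr a (i.eval s) (e.eval s) := rfl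

theorem eval_ite (b : Test) (p q : Code) (s : Store) :
    (ite b p q).eval s = if b.eval s = true then p.eval s else q.eval s := rfl

end Code

/-! ### Labellings -/

/-- What the main part of the program works on: the number of vertices, the capacity, the number
`u` of marked vertices (these form a vertex cover), the weights, and the marks. -/
structure Data where
  /-- number of vertices -/
  n : ℕ
  /-- capacity -/
  C : ℕ
  /-- number of marked vertices -/
  u : ℕ
  /-- weights -/
  W : ℕ → ℕ → ℕ
  /-- marks -/
  mark : ℕ → ℕ

namespace Data

variable (d : Data)

/-- The number of vertices with label `l`. -/
def count (c : ℕ → ℕ) (l : ℕ) : ℕ := ∑ v ∈ Finset.range d.n, if c v = l then 1 else 0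

/-- No label below `u` is used more than `C` times. -/
def Feas (c : ℕ → ℕ) : Prop := ∀ l < d.u, d.count c l ≤ d.C

/-- Twice the weight inside the classes of the labels below `u`. -/
def val (c : ℕ → ℕ) : ℕ :=
  ∑ i ∈ Finset.range d.n, ∑ j ∈ Finset.range d.n, if c i = c j ∧ c i < d.u then d.W i j else 0

/-- The weight from `v` to the marked vertices with label `j'` plus the weight from `h` to the
marked vertices with label `j`. -/
def swapGain (a : ℕ → ℕ) (v h j j' : ℕ) : ℕ :=
  ∑ w ∈ Finset.range d.n, if d.mark w = 1 then
    (if a w = j' then d.W v w else 0) + (if a w = j then d.W h w else 0) else 0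

/-- The vertices that the insertion of `x` may move out of class `j`. -/
def Movable (a : ℕ → ℕ) (x j v : ℕ) : Prop := d.mark v = 0 ∧ v ≤ x ∧ a v = j

instance (a : ℕ → ℕ) (x j v : ℕ) : Decidable (d.Movable a x j v) := by
  unfold Movable; infer_instance

/-- Among the vertices below `m`, one that it is best to move from class `j` to class `l`, and `n`
if there is none. -/
def victim (a : ℕ → ℕ) (x j l : ℕ) : ℕ → ℕ
  | 0 => d.n
  | m + 1 =>
    if d.Movable a x j m ∧ (victim a x j l m = d.n ∨
        d.swapGain a (victim a x j l m) m j l < d.swapGain a m (victim a x j l m) j l) then m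
    else victim a x j l m

/-- Move one vertex out of each class `j`, to the class `D j`. -/
def shift (a : ℕ → ℕ) (x : ℕ) (D : ℕ → ℕ) (v : ℕ) : ℕ :=
  if v = d.victim a x (a v) (D (a v)) d.n then D (a v) else a v

/-- Digit `t` of `k` in base `u + 1`. -/
def digit (k t : ℕ) : ℕ := k / (d.u + 1) ^ t % (d.u + 1)

/-- The number of digit sequences. -/
def codes : ℕ := (d.u + 1) ^ (d.u + 1)

/-- The number of marked vertices below `v`. -/
def rank (v : ℕ) : ℕ := ∑ w ∈ Finset.range v, if d.mark w = 1 then 1 else 0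

/-- The labelling that gives the marked vertices the digits of `k`, and all others the label `u`. -/
def start (k v : ℕ) : ℕ := if d.mark v = 1 then d.digit k (d.rank v) else d.u

variable {d}

theorem count_congr {c c' : ℕ → ℕ} (h : ∀ v < d.n, c v = c' v) (l : ℕ) :
    d.count c l = d.count c' l :=
  Finset.sum_congr rfl fun v hv => by rw [h v (Finset.mem_range.1 hv)]

theorem Feas.congr {c c' : ℕ → ℕ} (h : ∀ v < d.n, c v = c' v) (hc : d.Feas c) : d.Feas c' :=
  fun l hl => (count_congr h l).symm.le.trans (hc l hl)

theorem val_congr {c c' : ℕ → ℕ} (h : ∀ v < d.n, c v = c' v) : d.val c = d.val c' :=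
  Finset.sum_congr rfl fun i hi => Finset.sum_congr rfl fun j hj => by
    rw [h i (Finset.mem_range.1 hi), h j (Finset.mem_range.1 hj)]

end Data

/-- The memory `s` holds the data `d`. -/
structure Env (d : Data) (s : Store) : Prop where
  n : s.reg rN = d.n
  C : s.reg rCap = d.C
  u : s.reg rCover = d.u
  base : s.reg rBase = d.u + 1
  codes : s.reg rCodes = d.codes
  W : ∀ i j, s.arr aWeight (s.arr aOffset i + j) = d.W i j
  mark : ∀ v, s.arr aMark v = d.mark v

/-- The data survive any step that writes only registers in `L` and arrays in `La`; for concrete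
programs the side conditions are decidable. -/
theorem Env.frame {d : Data} {s s' : Store} (h : Env d s) {L La : List ℕ}
    (hL : ∀ y ∈ [rN, rCap, rCover, rBase, rCodes], y ∉ L)
    (hLa : ∀ a ∈ [aWeight, aOffset, aMark], a ∉ La)
    (fr : ∀ y, y ∉ L → s'.reg y = s.reg y) (fa : ∀ a, a ∉ La → s'.arr a = s.arr a) :
    Env d s' := by
  simp at hL hLa
  obtain ⟨h0, h1, h2, h3, h4⟩ := hL
  obtain ⟨k0, k1, k2⟩ := hLa
  exact ⟨by rw [fr _ h0, h.n], by rw [fr _ h1, h.C], by rw [fr _ h2, h.u], by rw [fr _ h3, h.base],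
    by rw [fr _ h4, h.codes], fun i j => by rw [fa _ k0, fa _ k1, h.W],
    fun v => by rw [fa _ k2, h.mark]⟩

theorem Env.eval {d : Data} {s : Store} (h : Env d s) (p : Code)
    (hL : ∀ y ∈ [rN, rCap, rCover, rBase, rCodes], y ∉ p.regs)
    (hLa : ∀ a ∈ [aWeight, aOffset, aMark], a ∉ p.arrs) : Env d (p.eval s) :=
  h.frame hL hLa (fun _ => Code.eval_reg) (fun _ => Code.eval_arr)

/-! ### Subroutines: digits, feasibility, value, best vertex to move -/

namespace Code

variable {d : Data} {s : Store}

/-- Subtract the base as often as possible. -/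
def subtractLoop : Code :=
  rep rZ rCodes
    (ite (.lt (.reg rRem) (.reg rBase)) skip
      (set rRem (.sub (.reg rRem) (.reg rBase)) ;; set rQuot (.add (.reg rQuot) (.const 1))))

/-- Division with remainder by repeated subtraction. -/
def divMod : Code := set rQuot (.const 0) ;; set rRem (.reg rNum) ;; subtractLoop

/-- The number of rounds must be fixed in advance; `codes` rounds suffice because the quotient is at
most the number itself, and surplus rounds do nothing. -/
theorem divMod_spec (hE : Env d s) (hk : s.reg rNum < d.codes) :
    (divMod.eval s).reg rQuot = s.reg rNum / (d.u + 1) ∧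
      (divMod.eval s).reg rRem = s.reg rNum % (d.u + 1) := by
  set k := s.reg rNum with hkdef
  simp only [divMod, eval_seq, eval_set, Expr.eval]
  set s₁ := (s.setReg rQuot 0).setReg rRem ((s.setReg rQuot 0).reg rNum) with hs₁
  have hE₁ : Env d s₁ := hE.frame (L := [rQuot, rRem]) (La := []) (by decide) (by decide)
    (fun y hy => by simp at hy; simp [hs₁, Store.setReg_reg, hy]) (fun a _ => rfl)
  obtain ⟨h1, h2⟩ : k = (subtractLoop.eval s₁).reg rQuot * (d.u + 1) +
      (subtractLoop.eval s₁).reg rRem ∧ ((subtractLoop.eval s₁).reg rRem < d.u + 1 ∨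
        (subtractLoop.eval s₁).reg rQuot = d.codes) := by
    refine rep_inv (fun i s' => k = s'.reg rQuot * (d.u + 1) + s'.reg rRem ∧
      (s'.reg rRem < d.u + 1 ∨ s'.reg rQuot = i)) d.codes hE₁.codes
      (by simp [Store.setReg_reg, hs₁, hkdef]) ?_
    intro i s' hi hx fr fa ⟨h1, h2⟩
    have hE' : Env d s' := hE₁.frame (by decide) (by decide) fr fa
    simp only [eval_ite, eval_seq, eval_set, eval_skip, Test.eval, Expr.eval, hE'.base]
    by_cases hlt : s'.reg rRem < d.u + 1
    · simp [hlt, Store.setReg_reg, ← h1]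
    · have hq : s'.reg rQuot = i := by omega
      simp [hlt, Store.setReg_reg, hq]
      rw [h1, hq, Nat.add_mul]; omega
  generalize subtractLoop.eval s₁ = s₂ at *
  -- A quotient equal to `codes` would make the number at least `codes`.
  have hlt : s₂.reg rRem < d.u + 1 := by
    refine h2.resolve_right fun h => ?_
    rw [h, Nat.mul_add] at h1
    omega
  rw [h1, mul_comm, Nat.mul_add_div (Nat.succ_pos _), Nat.mul_add_mod, Nat.mod_eq_of_lt hlt,
    Nat.div_eq_of_lt hlt]
  simp

/-- Decode a number into its digits. -/
def digits : Code :=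
  rep rPos rBase (divMod ;; put aDigit (.reg rPos) (.reg rRem) ;; set rNum (.reg rQuot))

theorem digits_spec (hE : Env d s) (hk : s.reg rNum < d.codes) {t : ℕ} (ht : t ≤ d.u) :
    (digits.eval s).arr aDigit t = d.digit (s.reg rNum) t := by
  set k := s.reg rNum with hkdef
  refine (rep_inv (s := s) (x := rPos) (b := rBase)
    (p := divMod ;; put aDigit (.reg rPos) (.reg rRem) ;; set rNum (.reg rQuot))
    (fun i s' => s'.reg rNum = k / (d.u + 1) ^ i ∧ ∀ t < i, s'.arr aDigit t = d.digit k t)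
    (d.u + 1) hE.base (by simp [Store.setReg_reg, hkdef]) ?_).2 t (by omega)
  intro i s' hi hx fr fa ⟨h1, h2⟩
  have hE' : Env d s' := hE.frame (by decide) (by decide) fr fa
  obtain ⟨hq, hr⟩ := divMod_spec hE' (by rw [h1]; exact (Nat.div_le_self _ _).trans_lt hk)
  simp only [eval_seq, eval_put, eval_set, Expr.eval]
  refine ⟨by simp [Store.setReg_reg, hq, h1, Nat.div_div_eq_div_mul, pow_succ], fun t ht => ?_⟩
  simp only [Store.setReg_arr, Store.setArr_arr, true_and]
  rw [eval_reg (y := rPos) (by decide), hx, hr, h1, eval_arr (a := aDigit) (by decide)]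
  split
  · next h => subst h; rfl
  · exact h2 t (by omega)

/-- Copy an array. -/
def copy (src dst : ℕ) : Code := rep rY rN (put dst (.reg rY) (.read src (.reg rY)))

theorem copy_spec (hE : Env d s) {src dst : ℕ} (h : src ≠ dst) {v : ℕ} (hv : v < d.n) :
    ((copy src dst).eval s).arr dst v = s.arr src v := by
  refine rep_inv (s := s) (x := rY) (b := rN) (p := put dst (.reg rY) (.read src (.reg rY)))
    (fun i s' => ∀ v < i, s'.arr dst v = s.arr src v) d.n hE.n (by simp) ?_ v hv
  intro i s' hi hx fr fa hI v hv
  simp only [eval_put, Expr.eval, Store.setReg_arr, Store.setArr_arr, true_and, hx]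
  rw [fa src (by simpa [arrs] using h)]
  split
  · next h => rw [h]
  · exact hI v (by omega)

/-- Count the vertices with label `rLabel`. -/
def countLabel : Code :=
  set rCount (.const 0) ;;
  rep rV rN (ite (.eq (.read aCand (.reg rV)) (.reg rLabel))
    (set rCount (.add (.reg rCount) (.const 1))) skip)

theorem countLabel_spec (hE : Env d s) :
    (countLabel.eval s).reg rCount = d.count (s.arr aCand) (s.reg rLabel) := by
  simp only [countLabel, eval_seq, eval_set, Expr.eval]
  set s₁ := s.setReg rCount 0 with hs₁
  have hE₁ : Env d s₁ := hE.frame (L := [rCount]) (La := []) (by decide) (by decide)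
    (fun y hy => by simp at hy; simp [hs₁, Store.setReg_reg, hy]) (fun a _ => rfl)
  refine rep_inv (fun m s' => s'.reg rCount = ∑ v ∈ Finset.range m,
    if s.arr aCand v = s.reg rLabel then 1 else 0) d.n hE₁.n (by simp [Store.setReg_reg, hs₁]) ?_
  intro m s' hm hx fr fa hI
  have e1 : s'.arr aCand = s.arr aCand := fa _ (by decide)
  have e2 : s'.reg rLabel = s.reg rLabel := by
    rw [fr _ (by decide)]; simp [hs₁, Store.setReg_reg]
  simp only [eval_ite, eval_set, eval_skip, Test.eval, Expr.eval, e1, e2, hx,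
    Finset.sum_range_succ]
  by_cases h : s.arr aCand m = s.reg rLabel <;> simp [h, Store.setReg_reg, hI]

/-- Check the capacities of the candidate. -/
def check : Code :=
  set rBad (.const 0) ;;
  rep rLabel rCover
    (countLabel ;; ite (.lt (.reg rCap) (.reg rCount)) (set rBad (.const 1)) skip)

theorem check_spec (hE : Env d s) : (check.eval s).reg rBad = 0 ↔ d.Feas (s.arr aCand) := by
  simp only [check, eval_seq, eval_set, Expr.eval]
  set s₁ := s.setReg rBad 0 with hs₁
  have hE₁ : Env d s₁ := hE.frame (L := [rBad]) (La := []) (by decide) (by decide)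
    (fun y hy => by simp at hy; simp [hs₁, Store.setReg_reg, hy]) (fun a _ => rfl)
  refine rep_inv (fun i s' => (s'.reg rBad = 0 ↔ ∀ l < i, d.count (s.arr aCand) l ≤ d.C)) d.u hE₁.u
    (by simp [Store.setReg_reg, hs₁]) ?_
  intro i s' hi hx fr fa hI
  have hE' : Env d s' := hE₁.frame (by decide) (by decide) fr fa
  have hc := countLabel_spec hE'
  rw [hx, show s'.arr aCand = s.arr aCand from fa _ (by decide)] at hc
  have hb : (countLabel.eval s').reg rBad = s'.reg rBad := eval_reg (by decide)
  have hC := (hE'.eval countLabel (by decide) (by decide)).C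
  have hst : (∀ l < i + 1, d.count (s.arr aCand) l ≤ d.C) ↔
      (s'.reg rBad = 0 ∧ d.count (s.arr aCand) i ≤ d.C) := by
    rw [hI]; exact Nat.forall_lt_succ_right
  rw [hst]
  simp only [eval_seq, eval_ite, eval_set, eval_skip, Test.eval, Expr.eval, hc, hC]
  by_cases h : d.C < d.count (s.arr aCand) i
  · simp [h, Store.setReg_reg]
  · simp [h, Store.setReg_reg, hb, not_lt.1 h]

/-- Compute twice the value of the candidate. -/
def value : Code :=
  set rVal (.const 0) ;;
  rep rI rN (rep rJ rN
    (ite (.and (.eq (.read aCand (.reg rI)) (.read aCand (.reg rJ)))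
        (.lt (.read aCand (.reg rI)) (.reg rCover)))
      (set rVal (.add (.reg rVal)
        (.read aWeight (.add (.read aOffset (.reg rI)) (.reg rJ))))) skip))

theorem value_spec (hE : Env d s) : (value.eval s).reg rVal = d.val (s.arr aCand) := by
  simp only [value, eval_seq, eval_set, Expr.eval]
  set s₁ := s.setReg rVal 0 with hs₁
  have hE₁ : Env d s₁ := hE.frame (L := [rVal]) (La := []) (by decide) (by decide)
    (fun y hy => by simp at hy; simp [hs₁, Store.setReg_reg, hy]) (fun a _ => rfl)
  set c := s.arr aCand with hc
  refine (rep_inv (s := s₁) (x := rI) (b := rN)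
    (fun m s' => s'.reg rVal = ∑ i ∈ Finset.range m, ∑ j ∈ Finset.range d.n,
      if c i = c j ∧ c i < d.u then d.W i j else 0) d.n hE₁.n
    (by simp [Store.setReg_reg, hs₁]) ?_)
  intro i s' hi hx fr fa hI
  have hE' : Env d s' := hE₁.frame (by decide) (by decide) fr fa
  have := (rep_inv (s := s') (x := rJ) (b := rN)
    (p := (ite (.and (.eq (.read aCand (.reg rI)) (.read aCand (.reg rJ)))
        (.lt (.read aCand (.reg rI)) (.reg rCover)))
      (set rVal (.add (.reg rVal)
        (.read aWeight (.add (.read aOffset (.reg rI)) (.reg rJ))))) skip))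
    (fun m s'' => s''.reg rVal = s'.reg rVal + ∑ j ∈ Finset.range m,
      if c i = c j ∧ c i < d.u then d.W i j else 0) d.n hE'.n
    (by simp [Store.setReg_reg]) (by
      intro j s'' hj hx' fr' fa' hI'
      have hE'' : Env d s'' := hE'.frame (by decide) (by decide) fr' fa'
      have e1 : s''.arr aCand = c := by
        rw [fa' _ (by decide)]; exact fa _ (by decide)
      have e2 : s''.reg rI = i := by rw [fr' _ (by decide), hx]
      simp only [eval_ite, eval_set, eval_skip, Test.eval, Expr.eval, e1, e2, hx', hE''.u, hE''.W,
        Finset.sum_range_succ]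
      by_cases h : c i = c j ∧ c i < d.u
      · simp [h.1 ▸ h.2, h.1, Store.setReg_reg, hI', add_assoc]
      · rw [if_neg (by simpa using h), if_neg h]; simp [Store.setReg_reg, hI']))
  rw [Store.setReg_reg, if_neg (by decide), this, hI, Finset.sum_range_succ]

/-- Compare the vertices `rV` and `rVictim` as vertices to be moved from class `rBin`. -/
def compare : Code :=
  set rGain (.const 0) ;; set rLoss (.const 0) ;;
  rep rW rN (ite (.eq (.read aMark (.reg rW)) (.const 1))
    (ite (.eq (.read aCur (.reg rW)) (.read aDigit (.reg rBin)))
      (set rGain (.add (.reg rGain)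
          (.read aWeight (.add (.read aOffset (.reg rV)) (.reg rW)))) ;;
        set rLoss (.add (.reg rLoss)
          (.read aWeight (.add (.read aOffset (.reg rVictim)) (.reg rW)))))
      skip ;;
    ite (.eq (.read aCur (.reg rW)) (.reg rBin))
      (set rGain (.add (.reg rGain)
          (.read aWeight (.add (.read aOffset (.reg rVictim)) (.reg rW)))) ;;
        set rLoss (.add (.reg rLoss)
          (.read aWeight (.add (.read aOffset (.reg rV)) (.reg rW)))))
      skip)
    skip)

theorem compare_spec (hE : Env d s) :
    (compare.eval s).reg rGain = d.swapGain (s.arr aCur) (s.reg rV) (s.reg rVictim) (s.reg rBin)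
        (s.arr aDigit (s.reg rBin)) ∧
      (compare.eval s).reg rLoss = d.swapGain (s.arr aCur) (s.reg rVictim) (s.reg rV)
        (s.reg rBin) (s.arr aDigit (s.reg rBin)) := by
  set a := s.arr aCur with ha
  set v := s.reg rV with hv
  set h := s.reg rVictim with hh
  set j := s.reg rBin with hj
  set j' := s.arr aDigit j with hj'
  simp only [compare, eval_seq, eval_set, Expr.eval]
  set s₁ := (s.setReg rGain 0).setReg rLoss 0 with hs₁
  have hE₁ : Env d s₁ := hE.frame (L := [rGain, rLoss]) (La := []) (by decide) (by decide)
    (fun y hy => by simp at hy; simp [hs₁, Store.setReg_reg, hy]) (fun a _ => rfl)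
  refine rep_inv (s := s₁) (x := rW) (b := rN)
    (fun m s' =>
      (s'.reg rGain = ∑ w ∈ Finset.range m, if d.mark w = 1 then
        (if a w = j' then d.W v w else 0) + (if a w = j then d.W h w else 0) else 0) ∧
      (s'.reg rLoss = ∑ w ∈ Finset.range m, if d.mark w = 1 then
        (if a w = j' then d.W h w else 0) + (if a w = j then d.W v w else 0) else 0))
    d.n hE₁.n (by simp [Store.setReg_reg, hs₁]) ?_
  intro w s' hw hx fr fa hI
  have hE' : Env d s' := hE₁.frame (by decide) (by decide) fr fa
  have e1 : s'.arr aCur = a := fa _ (by decide)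
  have e2 : s'.arr aDigit = s.arr aDigit := fa _ (by decide)
  have e3 : s'.reg rV = v := by rw [fr _ (by decide)]; simp [hs₁, Store.setReg_reg, hv]
  have e4 : s'.reg rVictim = h := by rw [fr _ (by decide)]; simp [hs₁, Store.setReg_reg, hh]
  have e5 : s'.reg rBin = j := by rw [fr _ (by decide)]; simp [hs₁, Store.setReg_reg, hj]
  simp only [eval_ite, eval_seq, eval_set, eval_skip, Test.eval, Expr.eval, e1, e2, e3, e5, hx,
    hE'.mark, hE'.W, Finset.sum_range_succ]
  clear_value j' a v h j
  subst hj'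
  by_cases h1 : d.mark w = 1
  · rcases Classical.propComplete (a w = s.arr aDigit j) with h2 | h2 <;>
      rcases Classical.propComplete (a w = j) with h3 | h3 <;>
      simp [h1, h2, h3, Store.setReg_reg, e1, e3, e4, e5, hx, hE'.W, hI, add_assoc]
  · simp [h1, Store.setReg_reg, hI]

/-- Find the best vertex to be moved out of class `rBin`. -/
def findVictim : Code :=
  set rVictim (.reg rN) ;;
  rep rV rN
    (ite (.and (.and (.eq (.read aMark (.reg rV)) (.const 0))
        (.not (.lt (.reg rX) (.reg rV)))) (.eq (.read aCur (.reg rV)) (.reg rBin)))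
      (compare ;; ite (.and (.not (.eq (.reg rVictim) (.reg rN)))
        (.not (.lt (.reg rLoss) (.reg rGain)))) skip (set rVictim (.reg rV)))
      skip)

theorem findVictim_spec (hE : Env d s) : (findVictim.eval s).reg rVictim =
    d.victim (s.arr aCur) (s.reg rX) (s.reg rBin) (s.arr aDigit (s.reg rBin)) d.n := by
  set a := s.arr aCur with ha
  set x := s.reg rX with hx
  set j := s.reg rBin with hj
  set j' := s.arr aDigit j with hj'
  simp only [findVictim, eval_seq, eval_set, Expr.eval]
  set s₁ := s.setReg rVictim (s.reg rN) with hs₁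
  have hE₁ : Env d s₁ := hE.frame (L := [rVictim]) (La := []) (by decide) (by decide)
    (fun y hy => by simp at hy; simp [hs₁, Store.setReg_reg, hy]) (fun a _ => rfl)
  refine rep_inv (s := s₁) (x := rV) (b := rN)
    (fun m s' => s'.reg rVictim = d.victim a x j j' m) d.n hE₁.n
    (by simp [Store.setReg_reg, hs₁, hE.n, Data.victim]) ?_
  intro v s' hv hxv fr fa hI
  have hE' : Env d s' := hE₁.frame (by decide) (by decide) fr fa
  have e1 : s'.arr aCur = a := fa _ (by decide)
  have e2 : s'.arr aDigit = s.arr aDigit := fa _ (by decide)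
  have e4 : s'.reg rX = x := by rw [fr _ (by decide)]; simp [hs₁, Store.setReg_reg, hx]
  have e5 : s'.reg rBin = j := by rw [fr _ (by decide)]; simp [hs₁, Store.setReg_reg, hj]
  obtain ⟨c1, c2⟩ := compare_spec hE'
  rw [e1, e2, e5, hxv, hI, ← hj'] at c1 c2
  have c3 : (compare.eval s').reg rVictim = d.victim a x j j' v := by
    rw [eval_reg (by decide), hI]
  have c4 : (compare.eval s').reg rV = v := by rw [eval_reg (by decide), hxv]
  have c5 := (hE'.eval compare (by decide) (by decide)).n
  simp only [eval_ite, eval_seq, eval_set, eval_skip, Test.eval, Expr.eval, e1, e4, e5,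
    hxv, hE'.mark, c1, c2, c3, c4, c5]
  rw [Data.victim]
  generalize d.victim a x j j' v = h at *
  by_cases hm : d.Movable a x j v
  · obtain ⟨m1, m2, m3⟩ := id hm
    simp only [hm, m1, m3, not_lt.2 m2, decide_true, decide_false, Bool.not_false, Bool.and_self,
      if_true, true_and, Store.setReg_reg, if_neg (show rVictim ≠ rV by decide)]
    by_cases h1 : h = d.n
    · simp [h1]
    · by_cases h2 : d.swapGain a h v j j' < d.swapGain a v h j j'
      · simp [h1, h2]
      · simp [h1, h2, c3]
  · have : ¬ ((d.mark v = 0 ∧ v ≤ x) ∧ a v = j) := by simpa [Data.Movable, and_assoc] using hm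
    simp [hm, this, Store.setReg_reg, hI]

end Code
end CoalitionFormation

/-! ### Trying all moves for one insertion, and the initial labelling -/

namespace CoalitionFormation

namespace Data

variable {d : Data}

theorem victim_spec (a : ℕ → ℕ) (x j j' m : ℕ) :
    d.victim a x j j' m = d.n ∨
      (d.victim a x j j' m < m ∧ d.Movable a x j (d.victim a x j j' m)) := by
  induction m with
  | zero => exact Or.inl rfl
  | succ m ih =>
    rw [victim]
    split
    · next h => exact Or.inr ⟨Nat.lt_succ_self _, h.1⟩
    · exact ih.imp_right fun h => ⟨h.1.trans (Nat.lt_succ_self _), h.2⟩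

theorem shift_congr {a D D' : ℕ → ℕ} {x v : ℕ} (h : D (a v) = D' (a v)) :
    d.shift a x D v = d.shift a x D' v := by
  simp [shift, h]

end Data

namespace Code

variable {d : Data} {s : Store}

/-- Move one vertex out of each class, as the digits say. -/
def shiftAll : Code :=
  copy aCur aCand ;;
  rep rBin rBase (findVictim ;; put aCand (.reg rVictim) (.read aDigit (.reg rBin)))

/-- Victims are sought in the old labelling `aCur` while the moves are written to `aCand`, so all
moves are simultaneous. If a class has no movable vertex, the write goes to cell `n`, which belongs
to no vertex. -/
theorem shiftAll_spec (hE : Env d s) {v : ℕ} (hv : v < d.n) (ha : s.arr aCur v ≤ d.u) :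
    (shiftAll.eval s).arr aCand v = d.shift (s.arr aCur) (s.reg rX) (s.arr aDigit) v := by
  set a := s.arr aCur with hadef
  set D := s.arr aDigit with hD
  set x := s.reg rX with hx
  simp only [shiftAll, eval_seq]
  have hE₁ : Env d ((copy aCur aCand).eval s) := hE.eval _ (by decide) (by decide)
  have hc := fun v (hv : v < d.n) => copy_spec hE (show aCur ≠ aCand by decide) hv
  have r1 : ((copy aCur aCand).eval s).reg rX = x := eval_reg (by decide)
  have r2 : ((copy aCur aCand).eval s).arr aCur = a := eval_arr (by decide)
  have r3 : ((copy aCur aCand).eval s).arr aDigit = D := eval_arr (by decide)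
  generalize (copy aCur aCand).eval s = s₁ at *
  have key := rep_inv (s := s₁) (x := rBin) (b := rBase)
    (p := findVictim ;; put aCand (.reg rVictim) (.read aDigit (.reg rBin)))
    (fun i s' => ∀ v < d.n, s'.arr aCand v =
      if a v < i ∧ v = d.victim a x (a v) (D (a v)) d.n then D (a v) else a v)
    (d.u + 1) hE₁.base (fun v hv => by simp [hc v hv, hadef]) ?_ v hv
  · rw [key, Data.shift]
    simp [ha]
  intro i s' hi hxi fr fa hI v hv
  have hE' : Env d s' := hE₁.frame (by decide) (by decide) fr fa
  have hvic := findVictim_spec hE'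
  rw [hxi, show s'.arr aCur = a by rw [fa _ (by decide), r2],
    show s'.arr aDigit = D by rw [fa _ (by decide), r3],
    show s'.reg rX = x by rw [fr _ (by decide), r1]] at hvic
  simp only [eval_seq, eval_put, Expr.eval, Store.setReg_arr, Store.setArr_arr, true_and, hvic]
  rw [eval_arr (a := aCand) (by decide), eval_arr (a := aDigit) (by decide),
    eval_reg (y := rBin) (by decide), hxi, fa aDigit (by decide), r3]
  by_cases h : v = d.victim a x i (D i) d.n
  · have hav : a v = i := by
      rcases Data.victim_spec (d := d) a x i (D i) d.n with h' | h'
      · omega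
      · rw [← h] at h'; exact h'.2.2.2
    rw [if_pos h, if_pos ⟨by omega, by rw [hav]; exact h⟩, hav]
  · rw [if_neg h, hI v hv]
    by_cases hav : a v = i
    · rw [hav]; simp [h]
    · have : a v < i + 1 ↔ a v < i := by omega
      simp only [this]

/-- If the candidate is feasible, and twice its value is at least the content of register `r`, then
copy it to the array `dst`, and update `r`. -/
def keep (dst r : ℕ) : Code :=
  check ;; value ;;
  ite (.and (.eq (.reg rBad) (.const 0)) (.lt (.reg r) (.add (.reg rVal) (.const 1))))
    (copy aCand dst ;; set r (.add (.reg rVal) (.const 1))) skip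

-- The register holds the best doubled value plus one, so that `0` can mean "nothing feasible found
-- yet" even when the best value is `0`.
open Classical in
theorem keep_spec (hE : Env d s) {dst r : ℕ} (hdst : aCand ≠ dst) (hr : r ∉ check.regs)
    (hr' : r ∉ value.regs) :
    if d.Feas (s.arr aCand) ∧ s.reg r < d.val (s.arr aCand) + 1 then
      ((keep dst r).eval s).reg r = d.val (s.arr aCand) + 1 ∧
        ∀ v < d.n, ((keep dst r).eval s).arr dst v = s.arr aCand v
    else ((keep dst r).eval s).reg r = s.reg r ∧
      ((keep dst r).eval s).arr dst = s.arr dst := by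
  have hE₁ := hE.eval check (by decide) (by decide)
  have hE₂ := hE₁.eval value (by decide) (by decide)
  have h1 : (value.eval (check.eval s)).reg rBad = 0 ↔ d.Feas (s.arr aCand) := by
    rw [eval_reg (by decide)]; exact check_spec hE
  have h2 : (value.eval (check.eval s)).reg rVal = d.val (s.arr aCand) := by
    rw [value_spec hE₁, eval_arr (by decide)]
  have h3 : (value.eval (check.eval s)).reg r = s.reg r := by
    rw [eval_reg hr', eval_reg hr]
  have h4 : ∀ a, (value.eval (check.eval s)).arr a = s.arr a := fun a => by
    rw [eval_arr (by simp [value, arrs]), eval_arr (by simp [check, countLabel, arrs])]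
  simp only [keep, eval_seq, eval_ite, eval_skip, eval_set]
  generalize value.eval (check.eval s) = s₂ at *
  by_cases h : d.Feas (s.arr aCand) ∧ s.reg r < d.val (s.arr aCand) + 1
  · have h0 := h1.2 h.1
    rw [if_pos h, if_pos (by simp [Test.eval, Expr.eval, h0, h2, h3]; omega)]
    have h5 := eval_reg (p := copy aCand dst) (s := s₂) (y := rVal) (by simp [copy, regs])
    refine ⟨by simp [Expr.eval, h5, h2], fun v hv => ?_⟩
    rw [Store.setReg_arr, copy_spec hE₂ hdst hv, h4]
  · rw [if_neg h, if_neg]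
    · exact ⟨h3, h4 _⟩
    · rw [← h1] at h
      simp only [Test.eval, Bool.and_eq_true, decide_eq_true_eq]
      simpa [Expr.eval, h2, h3] using h

/-- Insert the vertex `rX`: try all ways to move one vertex out of each class. -/
def insertOne : Code :=
  set rStageBest (.const 0) ;;
  rep rL rCodes (set rNum (.reg rL) ;; digits ;; shiftAll ;; keep aStageBest rStageBest) ;;
  copy aStageBest aCur

theorem insertOne_spec (hE : Env d s) {a : ℕ → ℕ} {x : ℕ} (ha : s.arr aCur = a)
    (hx : s.reg rX = x) (hle : ∀ v < d.n, a v ≤ d.u)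
    (hex : ∃ k < d.codes, d.Feas (d.shift a x (d.digit k))) :
    ∃ k < d.codes, d.Feas (d.shift a x (d.digit k)) ∧
      (∀ v < d.n, (insertOne.eval s).arr aCur v = d.shift a x (d.digit k) v) ∧
      ∀ k' < d.codes, d.Feas (d.shift a x (d.digit k')) →
        d.val (d.shift a x (d.digit k')) ≤ d.val (d.shift a x (d.digit k)) := by
  simp only [insertOne, eval_seq, eval_set, Expr.eval]
  set s₁ := s.setReg rStageBest 0 with hs₁
  have hE₁ : Env d s₁ := hE.frame (L := [rStageBest]) (La := []) (by decide) (by decide)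
    (fun y hy => by simp at hy; simp [hs₁, Store.setReg_reg, hy]) (fun a _ => rfl)
  have hE₂ := hE₁.eval
    (rep rL rCodes (set rNum (.reg rL) ;; digits ;; shiftAll ;; keep aStageBest rStageBest))
    (by decide) (by decide)
  have key := rep_inv (s := s₁) (x := rL) (b := rCodes)
    (p := set rNum (.reg rL) ;; digits ;; shiftAll ;; keep aStageBest rStageBest)
    (fun i s' => (s'.reg rStageBest = 0 ∧ ∀ k < i, ¬ d.Feas (d.shift a x (d.digit k))) ∨
      ∃ k < i, d.Feas (d.shift a x (d.digit k)) ∧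
        s'.reg rStageBest = d.val (d.shift a x (d.digit k)) + 1 ∧
        (∀ v < d.n, s'.arr aStageBest v = d.shift a x (d.digit k) v) ∧
        ∀ k' < i, d.Feas (d.shift a x (d.digit k')) →
          d.val (d.shift a x (d.digit k')) ≤ d.val (d.shift a x (d.digit k)))
    d.codes hE₁.codes (by simp [Store.setReg_reg, hs₁]) ?_
  · obtain ⟨k₀, hk₀, hf⟩ := hex
    rcases key with ⟨-, h⟩ | ⟨k, hk, h1, -, h3, h4⟩
    · exact absurd hf (h k₀ hk₀)
    · exact ⟨k, hk, h1, fun v hv => by rw [copy_spec hE₂ (by decide) hv, h3 v hv], h4⟩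
  intro i s' hi hxi fr fa hI
  have hE' : Env d s' := hE₁.frame (by decide) (by decide) fr fa
  have ha' : s'.arr aCur = a := by rw [fa _ (by decide)]; exact ha
  have hx' : s'.reg rX = x := by rw [fr _ (by decide)]; simp [hs₁, Store.setReg_reg, hx]
  simp only [eval_seq, eval_set, Expr.eval, hxi]
  set t₁ := s'.setReg rNum i with ht₁
  have hT₁ : Env d t₁ := hE'.frame (L := [rNum]) (La := []) (by decide) (by decide)
    (fun y hy => by simp at hy; simp [ht₁, Store.setReg_reg, hy]) (fun a _ => rfl)
  have hT₂ := hT₁.eval digits (by decide) (by decide)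
  have hT₃ := hT₂.eval shiftAll (by decide) (by decide)
  have hnum : t₁.reg rNum = i := by simp [ht₁]
  have hcand : ∀ v < d.n, (shiftAll.eval (digits.eval t₁)).arr aCand v =
      d.shift a x (d.digit i) v := fun v hv => by
    have e1 : (digits.eval t₁).arr aCur = a := by rw [eval_arr (by decide)]; exact ha'
    have e2 : (digits.eval t₁).reg rX = x := by
      rw [eval_reg (by decide)]; simp [ht₁, Store.setReg_reg, hx']
    rw [shiftAll_spec hT₂ hv (by rw [e1]; exact hle v hv), e1, e2]
    -- Only digits at positions up to `u` are decoded. The destination of `v` depends only on the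
    -- digit at its label, which is at most `u`.
    refine Data.shift_congr ?_
    rw [digits_spec hT₁ (by rw [hnum]; exact hi) (hle v hv), hnum]
  have hbest : (shiftAll.eval (digits.eval t₁)).reg rStageBest = s'.reg rStageBest := by
    rw [eval_reg (by decide), eval_reg (by decide)]; simp [ht₁, Store.setReg_reg]
  have harr : (shiftAll.eval (digits.eval t₁)).arr aStageBest = s'.arr aStageBest := by
    rw [eval_arr (by decide), eval_arr (by decide)]; rfl
  have hk := keep_spec hT₃ (dst := aStageBest) (r := rStageBest) (by decide) (by decide) (by decide)
  generalize shiftAll.eval (digits.eval t₁) = t₃ at *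
  have hfeas : d.Feas (t₃.arr aCand) ↔ d.Feas (d.shift a x (d.digit i)) :=
    ⟨Data.Feas.congr hcand, Data.Feas.congr fun v hv => (hcand v hv).symm⟩
  rw [hfeas, Data.val_congr hcand, hbest, harr] at hk
  rw [Store.setReg_reg, if_neg (by decide), Store.setReg_arr]
  generalize (keep aStageBest rStageBest).eval t₃ = t₄ at *
  by_cases h : d.Feas (d.shift a x (d.digit i)) ∧
      s'.reg rStageBest < d.val (d.shift a x (d.digit i)) + 1
  · rw [if_pos h] at hk
    refine Or.inr ⟨i, Nat.lt_succ_self i, h.1, hk.1, fun v hv => by rw [hk.2 v hv, hcand v hv],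
      fun k' hk' hf' => ?_⟩
    rcases Nat.lt_succ_iff_lt_or_eq.1 hk' with hlt | rfl
    · rcases hI with ⟨-, h0⟩ | ⟨k, -, -, h2, -, h4⟩
      · exact absurd hf' (h0 k' hlt)
      · exact (h4 k' hlt hf').trans (by omega)
    · exact le_rfl
  · rw [if_neg h] at hk
    rw [hk.1, hk.2]
    rcases hI with ⟨h0, h1⟩ | ⟨k, hk, h1, h2, h3, h4⟩
    · refine Or.inl ⟨h0, fun k hk hf => ?_⟩
      rcases Nat.lt_succ_iff_lt_or_eq.1 hk with hlt | rfl
      · exact h1 k hlt hf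
      · exact h ⟨hf, by omega⟩
    · refine Or.inr ⟨k, by omega, h1, h2, h3, fun k' hk' hf' => ?_⟩
      rcases Nat.lt_succ_iff_lt_or_eq.1 hk' with hlt | rfl
      · exact h4 k' hlt hf'
      · by_contra hlt
        exact h ⟨hf', by omega⟩

/-- Insert all unmarked vertices, one by one. -/
def insertAll : Code := rep rX rN (ite (.eq (.read aMark (.reg rX)) (.const 0)) insertOne skip)

/-- The property `P` is left abstract to separate the machine from the combinatorics; it becomes
"optimal once the unmarked vertices below `x` are inserted". `hcongr` is needed because the array is
controlled only below `n`. -/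
theorem insertAll_spec (hE : Env d s) (P : ℕ → (ℕ → ℕ) → Prop)
    (hcongr : ∀ {x a a'}, (∀ v < d.n, a v = a' v) → P x a → P x a')
    (hle : ∀ {x a}, P x a → ∀ v < d.n, a v ≤ d.u)
    (hex : ∀ {x a}, x < d.n → d.mark x = 0 → P x a →
      ∃ k < d.codes, d.Feas (d.shift a x (d.digit k)))
    (hstep : ∀ {x a k}, x < d.n → d.mark x = 0 → P x a → k < d.codes →
      d.Feas (d.shift a x (d.digit k)) →
      (∀ k' < d.codes, d.Feas (d.shift a x (d.digit k')) →
        d.val (d.shift a x (d.digit k')) ≤ d.val (d.shift a x (d.digit k))) →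
      P (x + 1) (d.shift a x (d.digit k)))
    (hskip : ∀ {x a}, x < d.n → d.mark x ≠ 0 → P x a → P (x + 1) a)
    (h0 : P 0 (s.arr aCur)) : P d.n ((insertAll.eval s).arr aCur) := by
  refine rep_inv (fun i s' => P i (s'.arr aCur)) d.n hE.n h0 ?_
  intro i s' hi hxi fr fa hI
  have hE' : Env d s' := hE.frame (by decide) (by decide) fr fa
  simp only [eval_ite, eval_skip, Test.eval, Expr.eval, hxi, hE'.mark, Store.setReg_arr]
  by_cases hm : d.mark i = 0
  · rw [if_pos (by simpa using hm)]
    obtain ⟨k, hk, h1, h2, h3⟩ := insertOne_spec hE' rfl hxi (hle hI) (hex hi hm hI)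
    exact hcongr (fun v hv => (h2 v hv).symm) (hstep hi hm hI hk h1 h3)
  · rw [if_neg (by simpa using hm)]
    exact hskip hi hm hI

/-- Give the marked vertices the digits as labels, and `u` to all others. -/
def startCode : Code :=
  set rCount (.const 0) ;;
  rep rV rN (ite (.eq (.read aMark (.reg rV)) (.const 1))
    (put aCur (.reg rV) (.read aDigit (.reg rCount)) ;;
      set rCount (.add (.reg rCount) (.const 1)))
    (put aCur (.reg rV) (.reg rCover)))

theorem startCode_spec (hE : Env d s) {k : ℕ}
    (hD : ∀ t ≤ d.u, s.arr aDigit t = d.digit k t)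
    (hr : ∀ v < d.n, d.mark v = 1 → d.rank v ≤ d.u) :
    ∀ v < d.n, (startCode.eval s).arr aCur v = d.start k v := by
  simp only [startCode, eval_seq, eval_set, Expr.eval]
  set s₁ := s.setReg rCount 0 with hs₁
  have hE₁ : Env d s₁ := hE.frame (L := [rCount]) (La := []) (by decide) (by decide)
    (fun y hy => by simp at hy; simp [hs₁, Store.setReg_reg, hy]) (fun a _ => rfl)
  refine (rep_inv (s := s₁) (fun i s' => s'.reg rCount = d.rank i ∧
    ∀ v < i, s'.arr aCur v = d.start k v) d.n hE₁.n
    (by simp [Store.setReg_reg, hs₁, Data.rank]) ?_).2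
  intro i s' hi hxi fr fa ⟨h1, h2⟩
  have hE' : Env d s' := hE₁.frame (by decide) (by decide) fr fa
  have hD' : s'.arr aDigit = s.arr aDigit := fa _ (by decide)
  simp only [eval_ite, eval_seq, eval_set, eval_put, Test.eval, Expr.eval, hxi, hE'.mark, hE'.u,
    hD', h1]
  have hrank : d.rank (i + 1) = d.rank i + if d.mark i = 1 then 1 else 0 :=
    Finset.sum_range_succ _ _
  by_cases hm : d.mark i = 1
  · rw [if_pos (by simpa using hm)]
    refine ⟨by simp [Store.setReg_reg, h1, hrank, hm], fun v hv => ?_⟩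
    simp only [Store.setReg_arr, Store.setArr_arr, true_and]
    split
    · next h => rw [h, Data.start, if_pos hm, hD _ (hr i hi hm)]
    · exact h2 v (by omega)
  · rw [if_neg (by simpa using hm)]
    refine ⟨by simp [Store.setReg_reg, h1, hrank, hm], fun v hv => ?_⟩
    simp only [Store.setReg_arr, Store.setArr_arr, true_and]
    split
    · next h => rw [h, Data.start, if_neg hm]
    · exact h2 v (by omega)

end Code
end CoalitionFormation

namespace CoalitionFormation

/-! ### Inserting an element into an optimal assignment -/

section Assignment

open Finset

/-- Used twice in the exchange argument: to reach the maximum, by minimizing the defect from an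
upper bound, and then to choose an optimum closest to a given assignment. -/
theorem exists_minimizer {α : Type*} (P : α → Prop) (f : α → ℕ) (h : ∃ a, P a) :
    ∃ a, P a ∧ ∀ b, P b → f a ≤ f b := by
  obtain ⟨a, ha, hmin⟩ := (measure f).wf.has_min {a | P a} h
  exact ⟨a, ha, fun b hb => not_lt.1 (hmin b hb)⟩

/-- The assignment `A`, with `e j` moved from `j` to `σ j` for all `j ∈ J`. -/
def move (A : ℕ → ℕ) (J : Finset ℕ) (e σ : ℕ → ℕ) (v : ℕ) : ℕ :=
  if A v ∈ J ∧ e (A v) = v then σ (A v) else A v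

/-- The number of elements of `V` that are assigned to `l`. -/
def load (V : Finset ℕ) (A : ℕ → ℕ) (l : ℕ) : ℕ := ∑ v ∈ V, if A v = l then 1 else 0

variable {V : Finset ℕ} {A : ℕ → ℕ}

/-- Since `A (e j) = j`, the map `e` is injective on `J`, so summing over `J` is summing over the
moved elements. The identity is arranged to avoid subtraction. It serves both for values and, with
indicator functions, for class sizes. -/
theorem sum_move {J : Finset ℕ} {e : ℕ → ℕ} (he : ∀ j ∈ J, e j ∈ V ∧ A (e j) = j)
    (σ : ℕ → ℕ) (F : ℕ → ℕ → ℕ) :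
    ∑ v ∈ V, F v (move A J e σ v) + ∑ j ∈ J, F (e j) j =
      ∑ v ∈ V, F v (A v) + ∑ j ∈ J, F (e j) (σ j) := by
  have key : ∀ G : ℕ → ℕ → ℕ, ∑ j ∈ J, G (e j) j =
      ∑ v ∈ V, if A v ∈ J ∧ e (A v) = v then G v (A v) else 0 := fun G => by
    rw [← sum_filter]
    refine sum_nbij' e A ?_ ?_ ?_ ?_ ?_
    · intro j hj
      simp [he j hj, hj]
    · intro v hv
      exact (mem_filter.1 hv).2.1
    · intro j hj
      exact (he j hj).2
    · intro v hv
      exact (mem_filter.1 hv).2.2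
    · intro j hj
      simp [he j hj]
  rw [key F, key fun v j => F v (σ j), ← sum_add_distrib, ← sum_add_distrib]
  refine sum_congr rfl fun v _ => ?_
  unfold move
  split <;> omega

theorem load_move {J : Finset ℕ} {e : ℕ → ℕ} (he : ∀ j ∈ J, e j ∈ V ∧ A (e j) = j)
    (σ : ℕ → ℕ) (l : ℕ) :
    load V (move A J e σ) l + ∑ j ∈ J, (if j = l then 1 else 0) =
      load V A l + ∑ j ∈ J, (if σ j = l then 1 else 0) :=
  sum_move he σ fun _ j => if j = l then 1 else 0

theorem load_lt_load {B : ℕ → ℕ} {j y : ℕ} (hy : y ∈ V) (hB : B y = j) (hA : A y ≠ j)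
    (h : ∀ v ∈ V, A v = j → B v = j) : load V A j < load V B j := by
  refine sum_lt_sum (fun v hv => ?_) ⟨y, hy, by simp [hA, hB]⟩
  by_cases hv' : A v = j
  · simp [hv', h v hv hv']
  · simp [hv']

/-- Telescoping: along a path every inner class loses one element and gains one, so only the two
ends change size. -/
theorem sum_path {p : ℕ → ℕ} {s T : ℕ} (hsT : s ≤ T) (l : ℕ) :
    ∑ r ∈ Ico s T, (if p (r + 1) = l then 1 else 0) + (if p s = l then 1 else 0) =
      ∑ r ∈ Ico s T, (if p r = l then 1 else 0) + (if p T = l then 1 else 0) := by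
  induction T, hsT using Nat.le_induction with
  | base => simp
  | succ T hT ih => rw [sum_Ico_succ_top hT, sum_Ico_succ_top hT]; omega

/-- The assignments with labels at most `u` that respect the capacity `C` of the labels below `u`,
and that agree with `A` on the elements that are not movable. -/
structure Admissible (V : Finset ℕ) (u C : ℕ) (M : ℕ → Prop) (A b : ℕ → ℕ) : Prop where
  fixed : ∀ v ∈ V, ¬ M v → b v = A v
  le : ∀ v ∈ V, b v ≤ u
  load : ∀ l < u, load V b l ≤ C

/-- Suppose that `A` is an optimal assignment among those that leave `x` in the class `u`
of unlimited capacity. Then an assignment that is optimal without this restriction arises by moving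
at most one element out of each class. -/
theorem exists_optimal_move {u C x : ℕ} {M : ℕ → Prop} {g : ℕ → ℕ → ℕ} (hxV : x ∈ V)
    (hxA : A x = u) (hA : Admissible V u C M A A)
    (hopt : ∀ b, Admissible V u C M A b → b x = A x →
      ∑ v ∈ V, g v (b v) ≤ ∑ v ∈ V, g v (A v)) :
    ∃ (J : Finset ℕ) (f σ : ℕ → ℕ), (∀ j ∈ J, f j ∈ V ∧ A (f j) = j ∧ M (f j) ∧ σ j ≤ u) ∧
      Admissible V u C M A (move A J f σ) ∧
      ∀ b, Admissible V u C M A b → ∑ v ∈ V, g v (b v) ≤ ∑ v ∈ V, g v (move A J f σ v) := by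
  classical
  -- `B` is optimal among all admissible assignments and, among the optimal ones, differs from `A`
  -- at as few elements as possible.
  obtain ⟨B, ⟨hB, hBmax⟩, hBmin⟩ : ∃ B, (Admissible V u C M A B ∧ ∀ b, Admissible V u C M A b →
      ∑ v ∈ V, g v (b v) ≤ ∑ v ∈ V, g v (B v)) ∧ ∀ b, (Admissible V u C M A b ∧
        ∀ b', Admissible V u C M A b' → ∑ v ∈ V, g v (b' v) ≤ ∑ v ∈ V, g v (b v)) →
        #{v ∈ V | B v ≠ A v} ≤ #{v ∈ V | b v ≠ A v} := by
    refine exists_minimizer _ _ ?_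
    obtain ⟨B, hB, hmin⟩ := exists_minimizer (Admissible V u C M A)
      (fun b => ∑ v ∈ V, ∑ j ∈ range (u + 1), g v j - ∑ v ∈ V, g v (b v)) ⟨A, hA⟩
    have bdd : ∀ b, Admissible V u C M A b →
        ∑ v ∈ V, g v (b v) ≤ ∑ v ∈ V, ∑ j ∈ range (u + 1), g v j := fun b hb =>
      sum_le_sum fun v hv => single_le_sum (f := g v) (fun _ _ => Nat.zero_le _)
        (mem_range.2 (Nat.lt_succ_of_le (hb.le v hv)))
    refine ⟨B, hB, fun b hb => ?_⟩
    have h1 := hmin b hb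
    have h2 := bdd b hb
    have h3 := bdd B hB
    omega
  by_cases hBx : B x = A x
  · refine ⟨∅, id, id, by simp, ?_⟩
    have hid : move A ∅ id id = A := by ext v; simp [move]
    rw [hid]
    exact ⟨hA, fun b hb => (hBmax b hb).trans (hopt B hB hBx)⟩
  -- Follow the moved elements, starting with `x`.
  let f : ℕ → ℕ := fun j => if h : j ≠ u ∧ ∃ v, v ∈ V ∧ A v = j ∧ B v ≠ j then h.2.choose else x
  obtain ⟨p, p_zero, p_succ⟩ : ∃ p : ℕ → ℕ, p 0 = u ∧ ∀ t, p (t + 1) = B (f (p t)) :=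
    ⟨fun t => Nat.rec u (fun _ j => B (f j)) t, rfl, fun _ => rfl⟩
  have f_mem : ∀ j, f j ∈ V := fun j => by
    by_cases h : j ≠ u ∧ ∃ v, v ∈ V ∧ A v = j ∧ B v ≠ j
    · simp only [f, dif_pos h]; exact h.2.choose_spec.1
    · simp only [f, dif_neg h]; exact hxV
  have f_spec : ∀ j, j ≠ u → (∃ v, v ∈ V ∧ A v = j ∧ B v ≠ j) → A (f j) = j ∧ B (f j) ≠ j :=
    fun j hj hv => by
      have h : j ≠ u ∧ ∃ v, v ∈ V ∧ A v = j ∧ B v ≠ j := ⟨hj, hv⟩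
      simp only [f, dif_pos h]; exact h.2.choose_spec.2
  have f_u : f u = x := by simp [f]
  have p_le : ∀ t, p t ≤ u := fun t => by
    cases t with
    | zero => exact p_zero.le
    | succ t => rw [p_succ]; exact hB.le _ (f_mem _)
  let slack : ℕ → Prop := fun j => j = u ∨ load V A j < C
  -- There are only `u + 1` classes, so the walk revisits one unless it meets a class with room
  -- first.
  have hex : ∃ T, 1 ≤ T ∧ (slack (p T) ∨ ∃ s < T, p s = p T) := by
    obtain ⟨s, -, t, -, hne, heq⟩ := exists_ne_map_eq_of_card_lt_of_maps_to
      (s := range (u + 2)) (t := range (u + 1)) (by simp) (f := p)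
      (fun t _ => by simpa [Nat.lt_succ_iff] using p_le t)
    rcases lt_or_gt_of_ne hne with h | h
    · exact ⟨t, by omega, Or.inr ⟨s, h, heq⟩⟩
    · exact ⟨s, by omega, Or.inr ⟨t, h, heq.symm⟩⟩
  let T := Nat.find hex
  obtain ⟨hT1, hT⟩ : 1 ≤ T ∧ (slack (p T) ∨ ∃ s < T, p s = p T) := Nat.find_spec hex
  have hTmin : ∀ t < T, 1 ≤ t → ¬ slack (p t) ∧ ∀ s < t, p s ≠ p t := fun t ht h1 => by
    have := Nat.find_min hex ht
    simp only [not_and, not_or, not_exists] at this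
    exact ⟨(this h1).1, fun s hs => (this h1).2 s hs⟩
  have p_inj : Set.InjOn p (Set.Iio T) := fun r hr t ht h => by
    by_contra hne
    rcases lt_or_gt_of_ne hne with h' | h'
    · exact (hTmin t ht (by omega)).2 r h' h
    · exact (hTmin r hr (by omega)).2 t h' h.symm
  have good : ∀ r < T, A (f (p r)) = p r ∧ B (f (p r)) ≠ p r := fun r => by
    induction r with
    | zero => intro _; rw [p_zero, f_u, ← hxA]; exact ⟨rfl, hBx⟩
    | succ r ih =>
      intro hr
      obtain ⟨h1, h2⟩ := ih (by omega)
      have hs := (hTmin (r + 1) hr (by omega)).1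
      simp only [slack, not_or, not_lt] at hs
      have hlt : p (r + 1) < u := lt_of_le_of_ne (p_le _) hs.1
      -- If no element left this class, `B` would have all of `A`'s elements there plus the newcomer
      -- `f (p r)`. But the class is full in `A`, so `B` would exceed the capacity.
      refine f_spec _ hs.1 ?_
      by_contra hno
      push Not at hno
      have := load_lt_load (f_mem (p r)) (p_succ r).symm (by rw [h1, p_succ]; exact h2.symm) hno
      have := hB.load _ hlt
      omega
  have movable : ∀ r < T, M (f (p r)) := fun r hr => by
    by_contra h
    have := hB.fixed _ (f_mem (p r)) h
    obtain ⟨h1, h2⟩ := good r hr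
    exact h2 (this.trans h1)
  obtain ⟨σ, hσ⟩ : ∃ σ : ℕ → ℕ, ∀ j, σ j = B (f j) := ⟨_, fun _ => rfl⟩
  let J : ℕ → Finset ℕ := fun s => (Ico s T).image p
  have hJ : ∀ s, ∀ j ∈ J s, ∃ r, s ≤ r ∧ r < T ∧ p r = j := fun s j hj => by
    simpa [J, and_assoc] using hj
  have he : ∀ s, ∀ j ∈ J s, f j ∈ V ∧ A (f j) = j := fun s j hj => by
    obtain ⟨r, -, hr, rfl⟩ := hJ s j hj
    exact ⟨f_mem _, (good r hr).1⟩
  -- `B'` is `B` with the moves along the walk from time `s` on undone. Applying these moves to `A`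
  -- and undoing them in `B` merely exchanges labels between the two, so any separable sum has the
  -- same total for the new pair as for `A` and `B` (`hsum`).
  let B' : ℕ → ℕ → ℕ := fun s v => if A v ∈ J s ∧ f (A v) = v then A v else B v
  have hsum : ∀ s (F : ℕ → ℕ → ℕ), ∑ v ∈ V, F v (move A (J s) f σ v) + ∑ v ∈ V, F v (B' s v) =
      ∑ v ∈ V, F v (A v) + ∑ v ∈ V, F v (B v) := fun s F => by
    rw [← sum_add_distrib, ← sum_add_distrib]
    refine sum_congr rfl fun v _ => ?_
    simp only [move, B', hσ]
    split
    · next h => rw [h.2, add_comm]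
    · rfl
  have hload : ∀ s ≤ T, ∀ l, load V (move A (J s) f σ) l + (if p s = l then 1 else 0) =
      load V A l + (if p T = l then 1 else 0) := fun s hs l => by
    have h1 := load_move (he s) σ l
    have hinj : Set.InjOn p (Ico s T : Finset ℕ) := p_inj.mono fun r hr => by
      simp at hr; exact hr.2
    rw [sum_image hinj, sum_image hinj] at h1
    have h2 := sum_path (p := p) hs l
    simp only [p_succ, ← hσ] at h2
    omega
  have hload' : ∀ s l, load V (move A (J s) f σ) l + load V (B' s) l = load V A l + load V B l :=
    fun s l => hsum s fun _ j => if j = l then 1 else 0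
  have fixed : ∀ s, ∀ v ∈ V, ¬ M v → move A (J s) f σ v = A v := fun s v _ hm => by
    rw [move, if_neg]
    rintro ⟨h1, h2⟩
    obtain ⟨r, -, hr, h⟩ := hJ s _ h1
    refine hm ?_
    rw [← h2, ← h]; exact movable r hr
  have le : ∀ s, ∀ v ∈ V, move A (J s) f σ v ≤ u := fun s v hv => by
    unfold move; split
    · rw [hσ]; exact hB.le _ (f_mem _)
    · exact hA.le v hv
  have fixed' : ∀ s, ∀ v ∈ V, ¬ M v → B' s v = A v := fun s v hv hm => by
    simp only [B']; split
    · rfl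
    · exact hB.fixed v hv hm
  have le' : ∀ s, ∀ v ∈ V, B' s v ≤ u := fun s v hv => by
    simp only [B']; split
    · exact hA.le v hv
    · exact hB.le v hv
  have hg := fun s => hsum s g
  -- With room at the end, the whole walk is applied to `A`. Undoing it in `B` returns `x` to class
  -- `u`, so `B'` is no better than `A`; by conservation the moved `A` is no worse than `B`.
  rcases Classical.em (slack (p T)) with hslack | hslack
  · have hadm : Admissible V u C M A (move A (J 0) f σ) := ⟨fixed 0, le 0, fun l hl => by
      have h := hload 0 (by omega) l
      have := hA.load l hl
      rw [if_neg (show p 0 ≠ l by omega)] at h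
      split at h
      · next h' =>
        rcases hslack with h'' | h''
        · omega
        · rw [h'] at h''; omega
      · omega⟩
    have hadm' : Admissible V u C M A (B' 0) := ⟨fixed' 0, le' 0, fun l hl => by
      have h := hload 0 (by omega) l
      have := hB.load l hl
      have := hload' 0 l
      rw [if_neg (show p 0 ≠ l by omega)] at h
      omega⟩
    have hx : B' 0 x = A x := by
      simp only [B']
      rw [if_pos]
      rw [hxA]
      exact ⟨mem_image.2 ⟨0, by simp; omega, p_zero⟩, f_u⟩
    refine ⟨J 0, f, σ, fun j hj => ?_, hadm, fun b hb => ?_⟩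
    · obtain ⟨r, -, hr, rfl⟩ := hJ 0 j hj
      exact ⟨f_mem _, (good r hr).1, movable r hr, by rw [hσ]; exact hB.le _ (f_mem _)⟩
    · have h1 := hopt _ hadm' hx
      have h2 := hBmax b hb
      have h3 := hg 0
      omega
  -- Otherwise the walk closes a cycle at `s`. It avoids class `u`, hence `x`, and it changes no
  -- class size; so moving along it cannot improve `A`, and `B'` remains optimal.
  · exfalso
    obtain ⟨s, hsT, hs⟩ := hT.resolve_left hslack
    have hs1 : 1 ≤ s := by
      by_contra h
      have : s = 0 := by omega
      subst this
      exact hslack (Or.inl (hs.symm.trans p_zero))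
    have hadm : Admissible V u C M A (move A (J s) f σ) := ⟨fixed s, le s, fun l hl => by
      have h := hload s hsT.le l
      have := hA.load l hl
      rw [hs] at h
      omega⟩
    have hadm' : Admissible V u C M A (B' s) := ⟨fixed' s, le' s, fun l hl => by
      have h := hload s hsT.le l
      have := hB.load l hl
      have := hload' s l
      rw [hs] at h
      omega⟩
    have hx : move A (J s) f σ x = A x := by
      rw [move, if_neg]
      rintro ⟨h1, -⟩
      obtain ⟨r, hr1, hr, h⟩ := hJ s _ h1
      exact (hTmin r hr (by omega)).1 (Or.inl (h.trans hxA))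
    have h1 := hopt _ hadm hx
    have h3 := hg s
    have h4 := hBmin (B' s) ⟨hadm', fun b hb => (hBmax b hb).trans (by omega)⟩
    -- But `B'` differs from `A` at fewer elements than `B` does: it agrees with `A` at `f (p s)`.
    refine absurd h4 (not_le.2 (card_lt_card ?_))
    obtain ⟨g1, g2⟩ := good s hsT
    have hmem : p s ∈ J s := mem_image.2 ⟨s, by simp [hsT], rfl⟩
    refine (ssubset_iff_of_subset fun v hv => ?_).2 ⟨f (p s), ?_, ?_⟩
    · simp only [mem_filter, B'] at hv ⊢
      refine ⟨hv.1, ?_⟩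
      by_cases h : A v ∈ J s ∧ f (A v) = v
      · simp [h] at hv
      · rw [if_neg h] at hv; exact hv.2
    · simp only [mem_filter]
      exact ⟨f_mem _, by rw [g1]; exact g2⟩
    · simp [B', g1, hmem]

end Assignment

end CoalitionFormation

/-! ### Optimal insertion of unmarked vertices -/

namespace CoalitionFormation

namespace Data

open Finset

variable {d : Data}

/-- The weight from `v` to the marked vertices with label `j`. -/
def gain (d : Data) (a : ℕ → ℕ) (v j : ℕ) : ℕ :=
  ∑ w ∈ range d.n, if d.mark w = 1 ∧ a w = j then d.W v w else 0

theorem swapGain_eq (a : ℕ → ℕ) (v h j j' : ℕ) :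
    d.swapGain a v h j j' = d.gain a v j' + d.gain a h j := by
  rw [swapGain, gain, gain, ← sum_add_distrib]
  refine sum_congr rfl fun w _ => ?_
  by_cases hm : d.mark w = 1 <;> simp [hm]

/-- The last inequality compares the changes `gain v j' - gain v j`, written without subtraction.
The scan keeps a running maximum of this change. -/
theorem victim_max (a : ℕ → ℕ) (x j j' : ℕ) {m : ℕ} (hm : m ≤ d.n) {v : ℕ} (hv : v < m)
    (hmov : d.Movable a x j v) : d.victim a x j j' m < d.n ∧
      d.Movable a x j (d.victim a x j j' m) ∧
      d.gain a v j' + d.gain a (d.victim a x j j' m) j ≤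
        d.gain a (d.victim a x j j' m) j' + d.gain a v j := by
  induction m with
  | zero => omega
  | succ m ih =>
    have hspec := victim_spec (d := d) a x j j' m
    rw [victim]
    simp only [swapGain_eq]
    set h := d.victim a x j j' m
    rcases Nat.lt_succ_iff_lt_or_eq.1 hv with hlt | rfl
    · obtain ⟨h1, h2, h3⟩ := ih (by omega) hlt
      split
      · next hc =>
        refine ⟨by omega, hc.1, ?_⟩
        have := hc.2.resolve_left h1.ne
        omega
      · exact ⟨h1, h2, h3⟩
    · split
      · exact ⟨by omega, hmov, by omega⟩
      · next hc =>
        simp only [hmov, true_and, not_or, not_lt] at hc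
        obtain ⟨h1, h2⟩ := hspec.resolve_left hc.1
        exact ⟨by omega, h2, hc.2⟩

theorem digit_le (k t : ℕ) : d.digit k t ≤ d.u :=
  Nat.lt_succ_iff.1 (Nat.mod_lt _ (Nat.succ_pos _))

/-- Base-`(u + 1)` expansion: the inverse of `finFunctionFinEquiv` reads off exactly the numbers
`digit k j`. -/
theorem exists_code {σ : ℕ → ℕ} (hσ : ∀ j ≤ d.u, σ j ≤ d.u) :
    ∃ k < d.codes, ∀ j ≤ d.u, d.digit k j = σ j := by
  let φ : Fin (d.u + 1) → Fin (d.u + 1) := fun j =>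
    ⟨σ j, Nat.lt_succ_iff.2 (hσ j (Nat.lt_succ_iff.1 j.2))⟩
  refine ⟨finFunctionFinEquiv φ, (finFunctionFinEquiv φ).2, fun j hj => ?_⟩
  have := congrFun (finFunctionFinEquiv.symm_apply_apply φ) ⟨j, Nat.lt_succ_iff.2 hj⟩
  exact congrArg Fin.val this

/-- The marks are `0` or `1`, the weight matrix is symmetric, and every edge has a marked end. -/
structure Nice (d : Data) : Prop where
  mark : ∀ v, d.mark v = 0 ∨ d.mark v = 1
  symm : ∀ i < d.n, ∀ j < d.n, d.W i j = d.W j i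
  indep : ∀ i < d.n, ∀ j < d.n, d.mark i = 0 → d.mark j = 0 → d.W i j = 0

/-- The contribution of an unmarked vertex `v` with label `j`. -/
def score (d : Data) (a : ℕ → ℕ) (v j : ℕ) : ℕ := if d.mark v = 0 then d.gain a v j else 0

/-- The value is a sum of contributions of the vertices outside of the cover. -/
theorem val_eq (hd : d.Nice) {a c : ℕ → ℕ} (ha : ∀ v < d.n, d.mark v = 1 → a v < d.u)
    (hc : ∀ v < d.n, d.mark v = 1 → c v = a v) :
    d.val c = ∑ i ∈ range d.n, ∑ j ∈ range d.n,
        (if d.mark i = 1 ∧ d.mark j = 1 ∧ a i = a j then d.W i j else 0) +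
      2 * ∑ v ∈ range d.n, d.score a v (c v) := by
  have h1 : ∑ v ∈ range d.n, d.score a v (c v) = ∑ i ∈ range d.n, ∑ j ∈ range d.n,
      if d.mark i = 0 ∧ d.mark j = 1 ∧ c i = a j then d.W i j else 0 :=
    sum_congr rfl fun i _ => by
      by_cases hm : d.mark i = 0
      · simp [score, gain, hm, eq_comm]
      · simp [score, hm]
  -- A pair of a marked and an unmarked vertex occurs in both orders in `val`; `h1` and `h2` account
  -- for one order each, whence the factor `2`.
  have h2 : ∑ v ∈ range d.n, d.score a v (c v) = ∑ i ∈ range d.n, ∑ j ∈ range d.n,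
      if d.mark j = 0 ∧ d.mark i = 1 ∧ c j = a i then d.W i j else 0 := by
    rw [h1, sum_comm]
    refine sum_congr rfl fun i hi => sum_congr rfl fun j hj => ?_
    rw [hd.symm j (mem_range.1 hj) i (mem_range.1 hi)]
  rw [two_mul]
  nth_rw 1 [h1]
  rw [h2, ← sum_add_distrib, ← sum_add_distrib]
  refine sum_congr rfl fun i hi => ?_
  rw [← sum_add_distrib, ← sum_add_distrib]
  refine sum_congr rfl fun j hj => ?_
  have hi := mem_range.1 hi
  have hj := mem_range.1 hj
  have ai := ha i hi
  have aj := ha j hj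
  have ci := hc i hi
  have cj := hc j hj
  have hind := hd.indep i hi j hj
  rcases hd.mark i with mi | mi <;> rcases hd.mark j with mj | mj <;>
    simp [mi, mj] at ai aj ci cj hind ⊢
  · exact fun _ _ => hind
  · rw [cj]
    by_cases h : c i = a j
    · simp [h, aj]
    · simp [h]
  · rw [ci]
    by_cases h : a i = c j
    · rw [← h]; simp [ai]
    · simp [h, Ne.symm h]
  · rw [ci, cj]
    simp [ai]

/-- The labellings that arise from `start k` by changing the labels of unmarked vertices
below `x`. -/
def Adm (d : Data) (k x : ℕ) (a : ℕ → ℕ) : Prop :=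
  Admissible (range d.n) d.u d.C (fun v => d.mark v = 0 ∧ v < x) (d.start k) a

/-- The optimal labellings among these. -/
def OptAt (d : Data) (k x : ℕ) (a : ℕ → ℕ) : Prop :=
  d.Adm k x a ∧ ∀ b, d.Adm k x b → d.val b ≤ d.val a

theorem Adm.congr {k x : ℕ} {a a' : ℕ → ℕ} (h : ∀ v < d.n, a v = a' v) (ha : d.Adm k x a) :
    d.Adm k x a' where
  fixed v hv hm := by rw [← h v (mem_range.1 hv)]; exact ha.fixed v hv hm
  le v hv := by rw [← h v (mem_range.1 hv)]; exact ha.le v hv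
  load l hl := (count_congr h l).symm.le.trans (ha.load l hl)

theorem OptAt.congr {k x : ℕ} {a a' : ℕ → ℕ} (h : ∀ v < d.n, a v = a' v) (ha : d.OptAt k x a) :
    d.OptAt k x a' :=
  ⟨ha.1.congr h, fun b hb => (ha.2 b hb).trans (val_congr h).le⟩

theorem Adm.eq_start {k x : ℕ} {a : ℕ → ℕ} (ha : d.Adm k x a) {v : ℕ} (hv : v < d.n)
    (hm : d.mark v = 1) : a v = d.start k v :=
  ha.fixed v (mem_range.2 hv) (by simp [hm])

theorem Adm.shift {k x k' : ℕ} {a : ℕ → ℕ} (ha : d.Adm k x a)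
    (hf : d.Feas (d.shift a x (d.digit k'))) : d.Adm k (x + 1) (d.shift a x (d.digit k')) where
  fixed v hv hm := by
    have : d.shift a x (d.digit k') v = a v := by
      unfold Data.shift
      split
      · next h =>
        rcases victim_spec (d := d) a x (a v) (d.digit k' (a v)) d.n with h' | h'
        · rw [← h] at h'; exact absurd h' (mem_range.1 hv).ne
        · rw [← h] at h'; exact absurd ⟨h'.2.1, Nat.lt_succ_of_le h'.2.2.1⟩ hm
      · rfl
    rw [this]
    exact ha.fixed v hv fun h => hm ⟨h.1, h.2.trans (Nat.lt_succ_self _)⟩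
  le v hv := by
    unfold Data.shift
    split
    · exact digit_le _ _
    · exact ha.le v hv
  load := hf

/-- Insertion of a vertex. -/
theorem OptAt.exists_shift (hd : d.Nice) {k : ℕ}
    (hk : ∀ v < d.n, d.mark v = 1 → d.start k v < d.u) {x : ℕ} {a : ℕ → ℕ}
    (ha : d.OptAt k x a) (hx : x < d.n) (hm : d.mark x = 0) :
    ∃ k' < d.codes, d.OptAt k (x + 1) (d.shift a x (d.digit k')) := by
  set V := range d.n with hV
  have hxV : x ∈ V := mem_range.2 hx
  have hgain : d.gain (d.start k) = d.gain a := by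
    ext v j
    refine sum_congr rfl fun w hw => ?_
    by_cases h : d.mark w = 1
    · rw [ha.1.eq_start (mem_range.1 hw) h]
    · simp [h]
  have hval : ∀ {y b}, d.Adm k y b → d.val b = _ := fun hb =>
    val_eq hd hk fun v hv hm' => hb.eq_start hv hm'
  let M : ℕ → Prop := fun v => d.mark v = 0 ∧ v < x + 1
  have base : ∀ v ∈ V, ¬ M v → a v = d.start k v := fun v hv h =>
    ha.1.fixed v hv fun h' => h ⟨h'.1, h'.2.trans (Nat.lt_succ_self _)⟩
  have adm_iff : ∀ b, Admissible V d.u d.C M a b ↔ d.Adm k (x + 1) b := fun b =>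
    ⟨fun h => ⟨fun v hv hm' => (h.fixed v hv hm').trans (base v hv hm'), h.le, h.load⟩,
      fun h => ⟨fun v hv hm' => (h.fixed v hv hm').trans (base v hv hm').symm, h.le, h.load⟩⟩
  have hxa : a x = d.start k x := ha.1.fixed x hxV (by simp)
  obtain ⟨J, f, σ, hJ, hadm, hmax⟩ := exists_optimal_move (V := V) (A := a) (u := d.u) (C := d.C)
    (x := x) (M := M) (g := d.score (d.start k)) hxV
    (by rw [hxa, start, if_neg (by omega)])
    ⟨fun _ _ _ => rfl, ha.1.le, ha.1.load⟩
    -- An assignment that keeps `x` in class `u` is admissible already at stage `x`, where `a` is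
    -- optimal.
    (fun b hb hbx => by
      have hb' : d.Adm k x b := ⟨fun v hv hm' => by
        by_cases hvx : v = x
        · rw [hvx, hbx, hxa]
        · have : ¬ M v := fun h => hm' ⟨h.1, by have := h.2; omega⟩
          rw [hb.fixed v hv this, base v hv this], hb.le, hb.load⟩
      have h := ha.2 b hb'
      rw [hval hb', hval ha.1, ← hV] at h
      omega)
  -- A class off the path gets itself as destination, so that its victim stays where it is.
  let σ' : ℕ → ℕ := fun j => if j ∈ J then σ j else j
  obtain ⟨k', hk', hdig⟩ := exists_code (d := d) (σ := σ') (fun j hj => by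
    simp only [σ']; split
    · next h => exact (hJ j h).2.2.2
    · exact hj)
  let q : ℕ → ℕ := fun j => d.victim a x j (σ j) d.n
  have hq : ∀ j ∈ J, q j < d.n ∧ d.Movable a x j (q j) ∧
      d.gain a (f j) (σ j) + d.gain a (q j) j ≤ d.gain a (q j) (σ j) + d.gain a (f j) j :=
    fun j hj => by
      obtain ⟨h1, h2, h3, -⟩ := hJ j hj
      exact victim_max a x j (σ j) le_rfl (mem_range.1 h1) ⟨h3.1, Nat.lt_succ_iff.1 h3.2, h2⟩
  have hshift : ∀ v < d.n, d.shift a x (d.digit k') v = move a J q σ v := fun v hv => by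
    rw [Data.shift, move, hdig _ (ha.1.le v (mem_range.2 hv))]
    by_cases h : a v ∈ J
    · simp only [σ', h, if_true, true_and, q, eq_comm]
    · simp [σ', h]
  have hq' : ∀ j ∈ J, q j ∈ V ∧ a (q j) = j := fun j hj =>
    ⟨mem_range.2 (hq j hj).1, (hq j hj).2.1.2.2⟩
  have hf' : ∀ j ∈ J, f j ∈ V ∧ a (f j) = j := fun j hj => ⟨(hJ j hj).1, (hJ j hj).2.1⟩
  -- Class sizes after the moves depend only on `J` and `σ`, not on which elements are moved; so the
  -- victims `q` may replace the path elements `f`.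
  have hfeas : d.Feas (d.shift a x (d.digit k')) := fun l hl => by
    have h1 := load_move hq' σ l
    have h2 := load_move hf' σ l
    have h3 := hadm.load l hl
    rw [count_congr hshift]
    change load V _ l ≤ _
    omega
  have hadm' := ha.1.shift hfeas
  refine ⟨k', hk', hadm', fun b hb => ?_⟩
  rw [hval hb, hval hadm']
  have h1 := hmax b ((adm_iff b).2 hb)
  have h2 := sum_move hq' σ (d.score (d.start k))
  have h3 := sum_move hf' σ (d.score (d.start k))
  have h4 : ∑ j ∈ J, d.score (d.start k) (f j) (σ j) + ∑ j ∈ J, d.score (d.start k) (q j) j ≤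
      ∑ j ∈ J, d.score (d.start k) (q j) (σ j) + ∑ j ∈ J, d.score (d.start k) (f j) j := by
    rw [← sum_add_distrib, ← sum_add_distrib]
    refine sum_le_sum fun j hj => ?_
    simp only [score, (hJ j hj).2.2.1.1, (hq j hj).2.1.1, if_true, hgain]
    exact (hq j hj).2.2
  have h5 : ∑ v ∈ V, d.score (d.start k) v (d.shift a x (d.digit k') v) =
      ∑ v ∈ V, d.score (d.start k) v (move a J q σ v) :=
    sum_congr rfl fun v hv => by rw [hshift v (mem_range.1 hv)]
  rw [← hV, h5]
  omega

/-- At stage `0` no label may change, so there is no competitor. -/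
theorem optAt_zero {k : ℕ} (hf : d.Feas (d.start k)) : d.OptAt k 0 (d.start k) :=
  ⟨⟨fun _ _ _ => rfl, fun v _ => by
    unfold start; split
    · exact digit_le _ _
    · exact le_rfl, hf⟩,
    fun b hb => (val_congr fun v hv => hb.fixed v (mem_range.2 hv) (by simp)).le⟩

theorem Adm.iff_of_mark {k x : ℕ} (hm : d.mark x ≠ 0) (a : ℕ → ℕ) :
    d.Adm k (x + 1) a ↔ d.Adm k x a := by
  have : (fun v => d.mark v = 0 ∧ v < x + 1) = fun v => d.mark v = 0 ∧ v < x := by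
    ext v
    refine and_congr_right fun h => ?_
    have : v ≠ x := by rintro rfl; exact hm h
    omega
  rw [Adm, this, Adm]

theorem OptAt.skip {k x : ℕ} {a : ℕ → ℕ} (hm : d.mark x ≠ 0) (ha : d.OptAt k x a) :
    d.OptAt k (x + 1) a :=
  ⟨(Adm.iff_of_mark hm a).2 ha.1, fun b hb => ha.2 b ((Adm.iff_of_mark hm b).1 hb)⟩

/-- The machine keeps some best feasible candidate, not necessarily the one from `exists_shift`;
being at least as good, it is optimal as well. -/
theorem OptAt.shift_of_max (hd : d.Nice) {k : ℕ}
    (hk : ∀ v < d.n, d.mark v = 1 → d.start k v < d.u) {x : ℕ} {a : ℕ → ℕ}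
    (ha : d.OptAt k x a) (hx : x < d.n) (hm : d.mark x = 0) {k' : ℕ}
    (hf : d.Feas (d.shift a x (d.digit k')))
    (hmax : ∀ l < d.codes, d.Feas (d.shift a x (d.digit l)) →
      d.val (d.shift a x (d.digit l)) ≤ d.val (d.shift a x (d.digit k'))) :
    d.OptAt k (x + 1) (d.shift a x (d.digit k')) := by
  obtain ⟨l, hl, ho⟩ := ha.exists_shift hd hk hx hm
  exact ⟨ha.1.shift hf, fun b hb => (ho.2 b hb).trans (hmax l hl ho.1.load)⟩

end Data

/-! ### Search over the labels of the cover -/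

namespace Code

variable {d : Data} {s : Store}

/-- Solve the problem for all labellings of the cover, and keep the best result. -/
def search : Code :=
  rep rK rCodes (set rNum (.reg rK) ;; digits ;; startCode ;; insertAll ;; copy aCur aCand ;;
    keep aBest rBest)

/-- Optimality is needed only in the round of the given `k`. The other rounds may start from useless
or infeasible labels; whatever they keep is feasible and no worse than what was kept before. -/
theorem search_spec (hE : Env d s) (hd : d.Nice) (h0 : s.reg rBest = 0)
    (hr : ∀ v < d.n, d.mark v = 1 → d.rank v ≤ d.u) {k : ℕ} (hk : k < d.codes)
    (hlt : ∀ v < d.n, d.mark v = 1 → d.start k v < d.u) (hf : d.Feas (d.start k)) :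
    d.Feas ((search.eval s).arr aBest) ∧
      ∀ b, d.Adm k d.n b → d.val b ≤ d.val ((search.eval s).arr aBest) := by
  have key := rep_inv (s := s) (x := rK) (b := rCodes)
    (p := set rNum (.reg rK) ;; digits ;; startCode ;; insertAll ;; copy aCur aCand ;;
      keep aBest rBest)
    (fun i s' => (s'.reg rBest = 0 ∨ (d.Feas (s'.arr aBest) ∧
      s'.reg rBest = d.val (s'.arr aBest) + 1)) ∧
      (k < i → ∀ b, d.Adm k d.n b → d.val b + 1 ≤ s'.reg rBest))
    d.codes hE.codes ⟨Or.inl (by simp [Store.setReg_reg, h0]), fun h => absurd h (by omega)⟩ ?_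
  · obtain ⟨h1, h2⟩ := key
    have h2 := h2 hk
    change (search.eval s).reg rBest = 0 ∨ (d.Feas ((search.eval s).arr aBest) ∧
      (search.eval s).reg rBest = d.val ((search.eval s).arr aBest) + 1) at h1
    change ∀ b, _ → _ ≤ (search.eval s).reg rBest at h2
    -- The start labelling itself competes, so `rBest` is positive at the end.
    have hadm : d.Adm k d.n (d.start k) := by
      obtain ⟨h, -⟩ := Data.optAt_zero hf
      exact ⟨fun _ _ _ => rfl, h.le, h.load⟩
    rcases h1 with h1 | ⟨h1, h3⟩
    · have := h2 _ hadm; omega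
    · exact ⟨h1, fun b hb => by have := h2 b hb; omega⟩
  intro i s' hi hxi fr fa ⟨h1, h2⟩
  have hE' : Env d s' := hE.frame (by decide) (by decide) fr fa
  simp only [eval_seq, eval_set, Expr.eval, hxi]
  set t₁ := s'.setReg rNum i with ht₁
  have hT₁ : Env d t₁ := hE'.frame (L := [rNum]) (La := []) (by decide) (by decide)
    (fun y hy => by simp at hy; simp [ht₁, Store.setReg_reg, hy]) (fun a _ => rfl)
  have hT₂ := hT₁.eval digits (by decide) (by decide)
  have hT₃ := hT₂.eval startCode (by decide) (by decide)
  have hT₄ := hT₃.eval insertAll (by decide) (by decide)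
  have hT₅ := hT₄.eval (copy aCur aCand) (by decide) (by decide)
  have hnum : t₁.reg rNum = i := by simp [ht₁]
  have hD : ∀ t ≤ d.u, (digits.eval t₁).arr aDigit t = d.digit i t := fun t ht => by
    rw [digits_spec hT₁ (by rw [hnum]; exact hi) ht, hnum]
  have hstart := startCode_spec hT₂ hD hr
  have hopt : i = k →
      d.OptAt k d.n ((insertAll.eval (startCode.eval (digits.eval t₁))).arr aCur) := by
    rintro rfl
    exact insertAll_spec hT₃ (d.OptAt i) (fun h ha => ha.congr h)
      (fun ha v hv => ha.1.le v (Finset.mem_range.2 hv))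
      (fun hx hm ha => (ha.exists_shift hd hlt hx hm).imp fun _ h => ⟨h.1, h.2.1.load⟩)
      (fun hx hm ha _ hf' hmax => ha.shift_of_max hd hlt hx hm hf' hmax)
      (fun _ hm ha => ha.skip hm)
      ((Data.optAt_zero hf).congr fun v hv => (hstart v hv).symm)
  have hopt' : i = k → d.OptAt k d.n
      (((copy aCur aCand).eval (insertAll.eval (startCode.eval (digits.eval t₁)))).arr aCand) :=
    fun h => (hopt h).congr fun v hv => (copy_spec hT₄ (by decide) hv).symm
  have hbest : ((copy aCur aCand).eval
      (insertAll.eval (startCode.eval (digits.eval t₁)))).reg rBest = s'.reg rBest := by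
    rw [eval_reg (by decide), eval_reg (by decide), eval_reg (by decide), eval_reg (by decide)]
    simp [ht₁, Store.setReg_reg]
  have harr : ((copy aCur aCand).eval
      (insertAll.eval (startCode.eval (digits.eval t₁)))).arr aBest = s'.arr aBest := by
    rw [eval_arr (by decide), eval_arr (by decide), eval_arr (by decide), eval_arr (by decide)]
    rfl
  have hkeep := keep_spec hT₅ (dst := aBest) (r := rBest) (by decide) (by decide) (by decide)
  generalize (copy aCur aCand).eval (insertAll.eval (startCode.eval (digits.eval t₁))) = t₅ at *
  rw [hbest, harr] at hkeep
  rw [Store.setReg_reg, if_neg (by decide), Store.setReg_arr]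
  generalize (keep aBest rBest).eval t₅ = t₆ at *
  by_cases h : d.Feas (t₅.arr aCand) ∧ s'.reg rBest < d.val (t₅.arr aCand) + 1
  · rw [if_pos h] at hkeep
    have hv := Data.val_congr hkeep.2
    refine ⟨Or.inr ⟨h.1.congr fun v hv => (hkeep.2 v hv).symm, by rw [hkeep.1, hv]⟩,
      fun hki b hb => ?_⟩
    rcases Nat.lt_succ_iff_lt_or_eq.1 hki with hlt' | rfl
    · have := h2 hlt' b hb; omega
    · have := (hopt' rfl).2 b hb; omega
  · rw [if_neg h] at hkeep
    rw [hkeep.1, hkeep.2]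
    refine ⟨h1, fun hki b hb => ?_⟩
    rcases Nat.lt_succ_iff_lt_or_eq.1 hki with hlt' | rfl
    · exact h2 hlt' b hb
    · have h3 := hopt' rfl
      have := h3.2 b hb
      by_contra hcon
      exact h ⟨h3.1.load, by omega⟩

end Code

end CoalitionFormation

/-! ### The vertex cover from a maximal matching, and the running time of the program -/

namespace CoalitionFormation

open Finset

/-- The vertices marked by `m` are the `u` ends of the edges of a matching, as far as this matters:
every vertex cover contains at least half of them. -/
structure IsMatched (n : ℕ) (adj : ℕ → ℕ → Prop) (m : ℕ → ℕ) (u : ℕ) : Prop where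
  mark : ∀ v, m v = 0 ∨ m v = 1
  sum : ∑ v ∈ range n, m v = u
  cover : ∀ K : Finset ℕ, (∀ i < n, ∀ j < n, adj i j → i ∈ K ∨ j ∈ K) →
    u ≤ 2 * ∑ v ∈ range n, if v ∈ K then m v else 0

/-- A vertex cover contains `i` or `j`, both previously unmarked, so its share of marks grows by at
least one while `u` grows by two. -/
theorem IsMatched.step {n : ℕ} {adj : ℕ → ℕ → Prop} {m m' : ℕ → ℕ} {u i j : ℕ}
    (h : IsMatched n adj m u) (hi : i < n) (hj : j < n) (hij : i ≠ j) (hadj : adj i j)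
    (mi : m i = 0) (mj : m j = 0)
    (hm' : ∀ v, m' v = m v + ((if v = i then 1 else 0) + (if v = j then 1 else 0))) :
    IsMatched n adj m' (u + 2) where
  mark v := by
    rw [hm']
    by_cases h1 : v = i
    · subst h1; simp [hij, mi]
    · by_cases h2 : v = j
      · subst h2; simp [h1, mj]
      · simpa [h1, h2] using h.mark v
  sum := by
    simp only [hm', sum_add_distrib, h.sum, sum_ite_eq', mem_range, hi, hj, if_true]
  cover K hK := by
    have h1 := h.cover K hK
    have h2 : ∀ v, (if v ∈ K then m' v else 0) = (if v ∈ K then m v else 0) +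
        ((if v = i then if i ∈ K then 1 else 0 else 0) +
          (if v = j then if j ∈ K then 1 else 0 else 0)) := fun v => by
      rw [hm']
      by_cases hv : v ∈ K
      · simp only [hv, if_true]
        congr 2
        · by_cases hvi : v = i
          · subst hvi; simp [hv]
          · simp [hvi]
        · by_cases hvj : v = j
          · subst hvj; simp [hv]
          · simp [hvj]
      · simp only [hv, if_false]
        have h1 : v = i → i ∉ K := fun h => h ▸ hv
        have h2 : v = j → j ∉ K := fun h => h ▸ hv
        by_cases hvi : v = i <;> by_cases hvj : v = j <;> simp [hvi, hvj] <;> simp_all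
    simp only [h2, sum_add_distrib, sum_ite_eq', mem_range, hi, hj, if_true]
    rcases hK i hi j hj hadj with h | h <;> simp only [h, if_true] <;> omega

namespace Code

variable {s : Store}

/-- Compute the positions of the rows of a matrix. -/
def offsets : Code :=
  rep rI rN (put aOffset (.reg rI) (.reg rOffset) ;;
    set rOffset (.add (.reg rOffset) (.reg rN)))

theorem offsets_spec (h0 : s.reg rOffset = 0) {i : ℕ} (hi : i < s.reg rN) :
    (offsets.eval s).arr aOffset i = s.reg rN * i := by
  refine (rep_inv (s := s) (fun i s' => s'.reg rOffset = s.reg rN * i ∧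
    ∀ j < i, s'.arr aOffset j = s.reg rN * j) (s.reg rN) rfl
    (by simp [Store.setReg_reg, h0]) ?_).2 i hi
  intro i s' hi hxi fr fa ⟨h1, h2⟩
  have hn : s'.reg rN = s.reg rN := fr _ (by decide)
  simp only [eval_seq, eval_put, eval_set, Expr.eval]
  refine ⟨by simp [Store.setReg_reg, h1, hn, Nat.mul_succ], fun j hj => ?_⟩
  simp only [Store.setReg_arr, Store.setArr_arr, true_and, hxi]
  split
  · next h => rw [h, h1]
  · exact h2 j (by omega)

/-- Mark the ends of the edges of a maximal matching. -/
def matching : Code :=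
  rep rI rN (rep rJ rN
    (ite (.and (.eq (.read aAdj (.add (.read aOffset (.reg rI)) (.reg rJ))) (.const 1))
        (.and (.eq (.read aMark (.reg rI)) (.const 0)) (.eq (.read aMark (.reg rJ)) (.const 0))))
      (put aMark (.reg rI) (.const 1) ;; put aMark (.reg rJ) (.const 1) ;;
        set rCover (.add (.reg rCover) (.const 2)))
      skip))

theorem matching_spec {n : ℕ} (hn : s.reg rN = n) (h0 : s.reg rCover = 0)
    (hm : ∀ v, s.arr aMark v = 0) {adj : ℕ → ℕ → Prop}
    (hadj : ∀ i < n, ∀ j < n, s.arr aAdj (s.arr aOffset i + j) = 1 ↔ adj i j)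
    (irrefl : ∀ i, ¬ adj i i) :
    IsMatched n adj ((matching.eval s).arr aMark) ((matching.eval s).reg rCover) ∧
      ∀ i < n, ∀ j < n, adj i j →
        (matching.eval s).arr aMark i = 1 ∨ (matching.eval s).arr aMark j = 1 := by
  refine rep_inv (s := s) (fun i s' => IsMatched n adj (s'.arr aMark) (s'.reg rCover) ∧
    ∀ i' < i, ∀ j < n, adj i' j → s'.arr aMark i' = 1 ∨ s'.arr aMark j = 1) n hn
    ⟨⟨fun v => Or.inl (hm v), by simp [hm, Store.setReg_reg, h0],
      fun K _ => by simp [Store.setReg_reg, h0]⟩, by simp⟩ ?_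
  intro i s' hi hxi fr fa hI
  have hn' : s'.reg rN = n := by rw [fr _ (by decide), hn]
  have key := rep_inv (s := s') (x := rJ) (b := rN)
    (p := ite (.and (.eq (.read aAdj (.add (.read aOffset (.reg rI)) (.reg rJ))) (.const 1))
        (.and (.eq (.read aMark (.reg rI)) (.const 0)) (.eq (.read aMark (.reg rJ)) (.const 0))))
      (put aMark (.reg rI) (.const 1) ;; put aMark (.reg rJ) (.const 1) ;;
        set rCover (.add (.reg rCover) (.const 2)))
      skip)
    (fun m s'' => IsMatched n adj (s''.arr aMark) (s''.reg rCover) ∧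
      (∀ i' < i, ∀ j < n, adj i' j → s''.arr aMark i' = 1 ∨ s''.arr aMark j = 1) ∧
      ∀ j < m, adj i j → s''.arr aMark i = 1 ∨ s''.arr aMark j = 1) n hn'
    ⟨by simpa [Store.setReg_reg] using hI.1, hI.2, by simp⟩ ?_
  · refine ⟨by rw [Store.setReg_reg, if_neg (by decide)]; exact key.1, fun i' hi' j hj ha => ?_⟩
    rcases Nat.lt_succ_iff_lt_or_eq.1 hi' with hlt | rfl
    · exact key.2.1 i' hlt j hj ha
    · exact key.2.2 j hj ha
  intro j s'' hj hxj fr' fa' ⟨h1, h2, h3⟩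
  have e1 : s''.reg rI = i := by rw [fr' _ (by decide), hxi]
  have e2 : s''.arr aAdj (s''.arr aOffset i + j) = 1 ↔ adj i j := by
    rw [← hadj i hi j hj, fa' _ (by decide), fa' _ (by decide), fa _ (by decide), fa _ (by decide)]
  have htest : Test.eval s'' (.and (.eq (.read aAdj (.add (.read aOffset (.reg rI)) (.reg rJ)))
      (.const 1)) (.and (.eq (.read aMark (.reg rI)) (.const 0))
        (.eq (.read aMark (.reg rJ)) (.const 0)))) = true ↔
      adj i j ∧ s''.arr aMark i = 0 ∧ s''.arr aMark j = 0 := by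
    simp only [Test.eval, Bool.and_eq_true, decide_eq_true_eq]
    simp only [Expr.eval, e1, hxj, e2]
  rw [eval_ite]
  by_cases h : adj i j ∧ s''.arr aMark i = 0 ∧ s''.arr aMark j = 0
  · have hij : i ≠ j := by rintro rfl; exact irrefl _ h.1
    rw [if_pos (htest.2 h)]
    simp only [eval_seq, eval_put, eval_set, Expr.eval, e1, Store.setReg_arr]
    have harr : ∀ v, ((s''.setArr aMark i 1).setArr aMark ((s''.setArr aMark i 1).reg rJ) 1).arr
        aMark v = s''.arr aMark v + ((if v = i then 1 else 0) + (if v = j then 1 else 0)) := by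
      intro v
      simp only [Store.setArr_arr, true_and, Store.setArr_reg, hxj]
      by_cases hvj : v = j
      · subst hvj; simp [Ne.symm hij, h.2.2]
      · by_cases hvi : v = i
        · subst hvi; simp [hvj, h.2.1]
        · simp [hvj, hvi]
    have hmono : ∀ v, s''.arr aMark v = 1 →
        ((s''.setArr aMark i 1).setArr aMark ((s''.setArr aMark i 1).reg rJ) 1).arr
          aMark v = 1 := by
      intro v hv
      simp only [Store.setArr_arr, true_and, hv, ite_self]
    refine ⟨?_, fun i' hi' j' hj' ha => (h2 i' hi' j' hj' ha).imp (hmono _) (hmono _),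
      fun j' hj' ha => ?_⟩
    · have := h1.step hi hj hij h.1 h.2.1 h.2.2 harr
      simpa [Store.setReg_reg] using this
    · left
      rw [harr]
      simp [h.2.1, hij]
  · rw [if_neg (fun h' => h (htest.1 h')), eval_skip]
    refine ⟨by simpa [Store.setReg_reg] using h1, h2, fun j' hj' ha => ?_⟩
    rw [Store.setReg_arr]
    rcases Nat.lt_succ_iff_lt_or_eq.1 hj' with hlt | rfl
    · exact h3 j' hlt ha
    -- Maximality: the test failed on an edge, so one end was already marked.
    · rcases h1.mark i with hmi | hmi
      · rcases h1.mark j' with hmj | hmj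
        · exact absurd ⟨ha, hmi, hmj⟩ h
        · exact Or.inr hmj
      · exact Or.inl hmi

/-- Multiply `rCodes` by the base. -/
def multiply : Code :=
  set rAcc (.const 0) ;; rep rJ rBase (set rAcc (.add (.reg rAcc) (.reg rCodes))) ;;
  set rCodes (.reg rAcc)

theorem multiply_spec : (multiply.eval s).reg rCodes = s.reg rBase * s.reg rCodes := by
  simp only [multiply, eval_seq, eval_set, Expr.eval]
  rw [Store.setReg_same]
  refine rep_inv (s := s.setReg rAcc 0) (x := rJ) (b := rBase)
    (fun i s' => s'.reg rAcc = i * s.reg rCodes) (s.reg rBase) (by simp [Store.setReg_reg])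
    (by simp [Store.setReg_reg]) ?_
  intro i s' hi hxi fr fa hI
  have : s'.reg rCodes = s.reg rCodes := by rw [fr _ (by decide)]; simp [Store.setReg_reg]
  simp only [eval_set, Expr.eval]
  simp [Store.setReg_reg, hI, this, Nat.add_mul]

/-- Compute the number of digit sequences. -/
def power : Code := set rCodes (.const 1) ;; rep rI rBase multiply

theorem power_spec : (power.eval s).reg rCodes = s.reg rBase ^ s.reg rBase := by
  simp only [power, eval_seq, eval_set, Expr.eval]
  refine rep_inv (s := s.setReg rCodes 1) (x := rI) (b := rBase)
    (fun i s' => s'.reg rCodes = s.reg rBase ^ i) (s.reg rBase) (by simp [Store.setReg_reg])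
    (by simp [Store.setReg_reg]) ?_
  intro i s' hi hxi fr fa hI
  have : s'.reg rBase = s.reg rBase := by rw [fr _ (by decide)]; simp [Store.setReg_reg]
  rw [Store.setReg_reg, if_neg (by decide), multiply_spec, hI, this, pow_succ']

/-- Give different labels to all vertices that are left alone. -/
def output : Code :=
  rep rV rN (ite (.lt (.read aBest (.reg rV)) (.reg rCover))
    (put aOut (.reg rV) (.read aBest (.reg rV)))
    (put aOut (.reg rV) (.add (.reg rCover) (.reg rV))))

theorem output_spec {d : Data} (hE : Env d s) : ∀ v < d.n, (output.eval s).arr aOut v =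
    if s.arr aBest v < d.u then s.arr aBest v else d.u + v := by
  refine rep_inv (s := s) (fun i s' => ∀ v < i, s'.arr aOut v =
    if s.arr aBest v < d.u then s.arr aBest v else d.u + v) d.n hE.n (by simp) ?_
  intro i s' hi hxi fr fa hI v hv
  have hE' : Env d s' := hE.frame (by decide) (by decide) fr fa
  have hb : s'.arr aBest = s.arr aBest := fa _ (by decide)
  simp only [eval_ite, eval_put, Test.eval, Expr.eval, hxi, hb, hE'.u, decide_eq_true_eq,
    Store.setReg_arr]
  by_cases hlt : s.arr aBest i < d.u
  · rw [if_pos hlt, Store.setArr_arr]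
    by_cases hvi : v = i
    · subst hvi; simp [hlt]
    · simp only [hvi, and_false, if_false]; exact hI v (by omega)
  · rw [if_neg hlt, Store.setArr_arr]
    by_cases hvi : v = i
    · subst hvi; simp [hlt]
    · simp only [hvi, and_false, if_false]; exact hI v (by omega)

/-- Compute the cover and the number of codes. -/
def prelude : Code := offsets ;; matching ;; set rBase (.add (.reg rCover) (.const 1)) ;; power

/-- The algorithm. -/
def solve : Code := prelude ;; search ;; output

/-- The algorithm halts, and the number of steps is polynomial in the number of vertices and the
number of codes. -/
theorem solve_runs {M : ℕ} (hn : s.reg rN ≤ M)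
    (hM : ((matching.eval (offsets.eval s)).reg rCover + 1) ^
      ((matching.eval (offsets.eval s)).reg rCover + 1) ≤ M) :
    ∃ t ≤ solve.bound M, Runs solve.toProgram s t (solve.eval s) := by
  set u := (matching.eval (offsets.eval s)).reg rCover with hu
  have hle : u + 1 ≤ (u + 1) ^ (u + 1) := Nat.le_self_pow (Nat.succ_ne_zero _) _
  set s₁ := (offsets ;; matching).eval s with hs₁
  set s₂ := (set rBase (.add (.reg rCover) (.const 1))).eval s₁ with hs₂
  set s₃ := power.eval s₂ with hs₃
  have n₁ : s₁.reg rN = s.reg rN := eval_reg (by decide)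
  have b₂ : s₂.reg rBase = u + 1 := Store.setReg_same _ _ _
  have r₃ : ∀ y ∈ [rN, rCover, rBase, rCodes], s₃.reg y ≤ M := by
    have h1 : s₃.reg rN = s.reg rN := by
      rw [hs₃, eval_reg (by decide), hs₂, eval_reg (by decide), n₁]
    have h2 : s₃.reg rCover = u := by
      rw [hs₃, eval_reg (by decide), hs₂, eval_reg (by decide)]; rfl
    have h3 : s₃.reg rBase = u + 1 := by rw [hs₃, eval_reg (by decide), b₂]
    have h4 : s₃.reg rCodes = (u + 1) ^ (u + 1) := by rw [hs₃, power_spec, b₂]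
    simp only [List.forall_mem_cons, h1, h2, h3, h4]
    exact ⟨hn, by omega, by omega, hM, by simp⟩
  -- The phases are timed separately, because a register that bounds loops in a later phase is still
  -- being computed in an earlier one.
  obtain ⟨t₁, l₁, e₁⟩ := runs (p := offsets) (s := s) (B := [rN]) (by decide) (M := M)
    (by simpa using hn)
  obtain ⟨t₂, l₂, e₂⟩ := runs (p := matching) (s := offsets.eval s) (B := [rN]) (by decide) (M := M)
    (by simpa [eval_reg (p := offsets) (y := rN) (by decide)] using hn)
  obtain ⟨t₃, l₃, e₃⟩ := runs (p := set rBase (.add (.reg rCover) (.const 1))) (s := s₁) (B := [])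
    (by decide) (M := M) (by simp)
  obtain ⟨t₄, l₄, e₄⟩ := runs (p := power) (s := s₂) (B := [rBase]) (by decide) (M := M)
    (by simp [b₂]; omega)
  obtain ⟨t₅, l₅, e₅⟩ := runs (p := search ;; output) (s := s₃)
    (B := [rN, rCover, rBase, rCodes]) (by decide) (M := M) r₃
  refine ⟨_, ?_, Runs.seq (Runs.seq e₁ (Runs.seq e₂ (Runs.seq e₃ e₄))) e₅⟩
  simp only [solve, prelude, bound] at *
  omega

end Code

end CoalitionFormation

/-! ### Partitions versus labellings -/

namespace CoalitionFormation

open Finset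

namespace Instance

variable (I : Instance)

theorem layout_apply {n : ℕ} (M : Fin n → Fin n → ℕ) (i j : Fin n) :
    layout M (n * i + j) = M i j := by
  have hlt : n * i + j < n * n := by
    calc n * i + j < n * i + n := by omega
      _ = n * (i + 1) := by ring
      _ ≤ n * n := Nat.mul_le_mul_left _ i.2
  have hn : 0 < n := i.pos
  rw [layout, dif_pos hlt]
  congr 1
  · ext; simp [Fin.divNat, Nat.mul_add_div hn, Nat.div_eq_of_lt j.2]
  · ext; simp [Fin.modNat, Nat.mod_eq_of_lt j.2]

theorem weightEntry_comm (i j : Fin I.n) : I.weightEntry i j = I.weightEntry j i := by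
  unfold weightEntry
  by_cases h : I.G.Adj i j
  · rw [dif_pos h, dif_pos h.symm]
    congr 1
    exact Subtype.ext Sym2.eq_swap
  · rw [dif_neg h, dif_neg fun h' => h h'.symm]

theorem weightEntry_of_not_adj {i j : Fin I.n} (h : ¬ I.G.Adj i j) : I.weightEntry i j = 0 :=
  dif_neg h

-- An edge has two distinct ends, so it is met by exactly two ordered pairs.
open Classical in
theorem sum_edgesIn (S : Finset (Fin I.n)) : 2 * ∑ e ∈ I.edgesIn S, I.w e =
    ∑ i, ∑ j, if i ∈ S ∧ j ∈ S then I.weightEntry i j else 0 := by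
  have h1 : ∀ e : I.G.edgeSet, ∀ x : ℕ,
      ∑ i, ∑ j, (if s(i, j) = (e : Sym2 (Fin I.n)) then x else 0) = 2 * x := by
    rintro ⟨e, he⟩ x
    induction e using Sym2.ind with
    | _ a b =>
      have hab : a ≠ b := I.G.ne_of_adj he
      have : ∀ i j, (if s(i, j) = s(a, b) then x else 0) =
          (if i = a then if j = b then x else 0 else 0) +
            (if i = b then if j = a then x else 0 else 0) := fun i j => by
        simp only [Sym2.eq_iff]
        by_cases hi : i = a
        · subst hi; simp [hab]
        · simp [hi, ite_and]
      simp only [this, sum_add_distrib]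
      simp [two_mul]
  have h2 : ∑ e ∈ I.edgesIn S, I.w e =
      ∑ e : I.G.edgeSet, if ∀ v ∈ (e : Sym2 (Fin I.n)), v ∈ S then I.w e else 0 := by
    rw [edgesIn, sum_filter]
  rw [h2, mul_sum, sum_congr rfl fun e _ => (h1 e _).symm, sum_comm]
  refine sum_congr rfl fun i _ => ?_
  rw [sum_comm]
  refine sum_congr rfl fun j _ => ?_
  by_cases h : I.G.Adj i j
  · rw [sum_eq_single ⟨s(i, j), h⟩]
    · simp [weightEntry, h]
    · intro e _ hne
      rw [if_neg]
      intro heq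
      exact hne (Subtype.ext heq.symm)
    · simp
  · rw [weightEntry_of_not_adj I h, ite_self]
    refine sum_eq_zero fun e _ => if_neg fun heq => h ?_
    have := e.2
    rw [← heq] at this
    exact this

theorem two_mul_value (P : I.VertexPartition) :
    2 * I.value P = ∑ i, ∑ j, if j ∈ P.part i then I.weightEntry i j else 0 := by
  rw [value, mul_sum, sum_congr rfl fun S _ => I.sum_edgesIn S, sum_comm]
  refine sum_congr rfl fun i _ => ?_
  rw [sum_comm]
  refine sum_congr rfl fun j _ => ?_
  rw [sum_eq_single (P.part i)]
  · simp [P.mem_part (mem_univ i)]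
  · intro S hS hne
    rw [if_neg]
    rintro ⟨hi, -⟩
    exact hne (P.part_eq_of_mem hS hi).symm
  · intro h
    exact absurd (P.part_mem.2 (mem_univ i)) h

end Instance

/-- The data describe the instance. -/
structure Describes (d : Data) (I : Instance) : Prop where
  n : d.n = I.n
  C : d.C = I.capacity
  nice : d.Nice
  W : ∀ i j : Fin I.n, d.W i j = I.weightEntry i j
  rank : d.rank d.n = d.u
  cover : ∀ i j : Fin I.n, I.G.Adj i j → d.mark i = 1 ∨ d.mark j = 1

theorem Data.rank_lt {d : Data} {v w : ℕ} (hvw : v < w) (hv : d.mark v = 1) :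
    d.rank v < d.rank w := by
  have h1 : d.rank (v + 1) = d.rank v + 1 := by
    rw [Data.rank, sum_range_succ, if_pos hv]; rfl
  have h2 : d.rank (v + 1) ≤ d.rank w :=
    sum_le_sum_of_subset (range_subset_range.2 hvw)
  omega

theorem Data.rank_inj {d : Data} {v w : ℕ} (hv : d.mark v = 1) (hw : d.mark w = 1)
    (heq : d.rank v = d.rank w) : v = w := by
  rcases lt_trichotomy v w with hlt | heq' | hlt
  · have := Data.rank_lt hlt hv; omega
  · exact heq'
  · have := Data.rank_lt hlt hw; omega

namespace Describes

variable {d : Data} {I : Instance}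

theorem sum_eq (h : Describes d I) (f : ℕ → ℕ) : ∑ v ∈ range d.n, f v = ∑ v : Fin I.n, f v := by
  rw [h.n, Finset.sum_range]

theorem val_eq (h : Describes d I) (c : ℕ → ℕ) : d.val c =
    ∑ i : Fin I.n, ∑ j : Fin I.n, if c i = c j ∧ c i < d.u then I.weightEntry i j else 0 := by
  rw [Data.val, h.sum_eq]
  refine sum_congr rfl fun i _ => ?_
  rw [h.sum_eq]
  simp only [h.W]

theorem count_eq (h : Describes d I) (c : ℕ → ℕ) (l : ℕ) :
    d.count c l = #{v : Fin I.n | c v = l} := by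
  rw [Data.count, h.sum_eq, card_filter]

theorem rank_lt_u (h : Describes d I) {v : ℕ} (hv : v < d.n) (hm : d.mark v = 1) :
    d.rank v < d.u := h.rank ▸ Data.rank_lt hv hm

/-- Label the coalitions that meet the cover by the rank of one of their members. -/
theorem exists_labels (h : Describes d I) (Q : I.VertexPartition) :
    ∃ c : ℕ → ℕ, (∀ v, c v ≤ d.u) ∧
      (∀ i : Fin I.n, ∀ v ∈ Q.part i, d.mark v = 1 → c i < d.u) ∧
      (∀ i j : Fin I.n, j ∈ Q.part i → c j = c i) ∧
      (∀ i j : Fin I.n, c i = c j → c i < d.u → j ∈ Q.part i) := by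
  classical
  let g : Finset (Fin I.n) → ℕ := fun S =>
    if h : ∃ v : Fin I.n, v ∈ S ∧ d.mark v = 1 then d.rank h.choose else d.u
  have g_pos : ∀ S, (∃ v : Fin I.n, v ∈ S ∧ d.mark v = 1) →
      ∃ v : Fin I.n, v ∈ S ∧ d.mark v = 1 ∧ g S = d.rank v :=
    fun S hS => ⟨hS.choose, hS.choose_spec.1, hS.choose_spec.2, by simp only [g, dif_pos hS]⟩
  have g_neg : ∀ S, (¬ ∃ v : Fin I.n, v ∈ S ∧ d.mark v = 1) → g S = d.u := fun S hS => by
    simp only [g, dif_neg hS]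
  have g_lt : ∀ S, (∃ v : Fin I.n, v ∈ S ∧ d.mark v = 1) → g S < d.u := fun S hS => by
    obtain ⟨v, -, hm, hv⟩ := g_pos S hS
    rw [hv]; exact h.rank_lt_u (by rw [h.n]; exact v.2) hm
  let c : ℕ → ℕ := fun v => if hv : v < I.n then g (Q.part ⟨v, hv⟩) else d.u
  have hc : ∀ i : Fin I.n, c i = g (Q.part i) := fun i => by simp [c]
  refine ⟨c, fun v => ?_, fun i v hv hm => ?_, fun i j hij => ?_, fun i j hij hlt => ?_⟩
  · by_cases hv : v < I.n
    · simp only [c, dif_pos hv]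
      by_cases hS : ∃ w ∈ Q.part ⟨v, hv⟩, d.mark w = 1
      · exact (g_lt _ hS).le
      · exact (g_neg _ hS).le
    · simp only [c, dif_neg hv]; exact le_rfl
  · rw [hc]; exact g_lt _ ⟨v, hv, hm⟩
  · rw [hc, hc, (Q.mem_part_iff_part_eq_part (mem_univ j) (mem_univ i)).1 hij]
  · rw [hc, hc] at hij
    rw [hc] at hlt
    have hSi : ∃ v ∈ Q.part i, d.mark v = 1 := by
      by_contra hno; rw [g_neg _ hno] at hlt; omega
    have hSj : ∃ v ∈ Q.part j, d.mark v = 1 := by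
      by_contra hno; rw [hij, g_neg _ hno] at hlt; omega
    obtain ⟨v, hv, mv, gv⟩ := g_pos _ hSi
    obtain ⟨w, hw, mw, gw⟩ := g_pos _ hSj
    have : v = w := Fin.ext (Data.rank_inj mv mw (by omega))
    subst this
    have e1 := (Q.mem_part_iff_part_eq_part (mem_univ v) (mem_univ i)).1 hv
    have e2 := (Q.mem_part_iff_part_eq_part (mem_univ v) (mem_univ j)).1 hw
    exact (Q.mem_part_iff_part_eq_part (mem_univ j) (mem_univ i)).2 (e2.symm.trans e1)

/-- For every partition some guess `k` is right on the cover. The resulting labelling loses no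
value: an edge inside a coalition has a marked end, so that coalition has a label below `u`. -/
theorem exists_start (h : Describes d I) (Q : I.VertexPartition) (hQ : I.IsCapacityPartition Q) :
    ∃ k < d.codes, (∀ v < d.n, d.mark v = 1 → d.start k v < d.u) ∧ d.Feas (d.start k) ∧
      ∃ c, d.Adm k d.n c ∧ 2 * I.value Q ≤ d.val c := by
  classical
  obtain ⟨c, c_le, c_lt, c_eq, c_mem⟩ := h.exists_labels Q
  -- Digit `t` is the label of the marked vertex of rank `t`; positions that are no rank get the
  -- default `0`.
  obtain ⟨k, hk, hdig⟩ := Data.exists_code (d := d)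
    (σ := fun t => if hv : ∃ v, d.mark v = 1 ∧ d.rank v = t then c hv.choose else 0) (fun t _ => by
      split
      · exact c_le _
      · exact Nat.zero_le _)
  have hstart : ∀ v < d.n, d.mark v = 1 → d.start k v = c v := fun v hv hm => by
    have hex : ∃ w, d.mark w = 1 ∧ d.rank w = d.rank v := ⟨v, hm, rfl⟩
    rw [Data.start, if_pos hm, hdig _ (h.rank_lt_u hv hm).le, dif_pos hex,
      Data.rank_inj hex.choose_spec.1 hm hex.choose_spec.2]
  have hself : ∀ i : Fin I.n, i ∈ Q.part i := fun i => Q.mem_part (mem_univ i)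
  have hlt : ∀ v < d.n, d.mark v = 1 → c v < d.u := fun v hv hm =>
    c_lt ⟨v, h.n ▸ hv⟩ ⟨v, h.n ▸ hv⟩ (hself _) hm
  have hfeas : d.Feas c := fun l hl => by
    rw [h.count_eq, h.C]
    rcases eq_empty_or_nonempty {v : Fin I.n | c v = l} with he | ⟨i, hi⟩
    · rw [he]; exact Nat.zero_le _
    · have hi : c i = l := by simpa using hi
      refine (card_le_card fun j hj => ?_).trans (hQ _ (Q.part_mem.2 (mem_univ i)))
      have hj : c j = l := by simpa using hj
      exact c_mem i j (hi.trans hj.symm) (by omega)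
  have hstart_lt : ∀ v < d.n, d.mark v = 1 → d.start k v < d.u := fun v hv hm => by
    rw [hstart v hv hm]; exact hlt v hv hm
  refine ⟨k, hk, hstart_lt, fun l hl => (sum_le_sum fun v hv => ?_).trans (hfeas l hl), c,
    ⟨fun v hv hm => ?_, fun v _ => c_le v, hfeas⟩, ?_⟩
  · have hv := mem_range.1 hv
    by_cases hm : d.mark v = 1
    · rw [hstart v hv hm]
    · rw [Data.start, if_neg hm, if_neg (by omega)]
      exact Nat.zero_le _
  · have hv := mem_range.1 hv
    exact (hstart v hv ((h.nice.mark v).resolve_left fun h0 => hm ⟨h0, hv⟩)).symm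
  · rw [I.two_mul_value, h.val_eq]
    refine sum_le_sum fun i _ => sum_le_sum fun j _ => ?_
    by_cases hadj : I.G.Adj i j
    · by_cases hj : j ∈ Q.part i
      · rw [if_pos hj, if_pos]
        refine ⟨(c_eq i j hj).symm, ?_⟩
        rcases h.cover i j hadj with hm | hm
        · exact c_lt i i (hself i) hm
        · exact c_lt i j hj hm
      · rw [if_neg hj]; exact Nat.zero_le _
    · rw [I.weightEntry_of_not_adj hadj]; simp

/-- A feasible labelling whose value is large enough describes an optimal partition. -/
theorem exists_optimal (h : Describes d I) {c out : ℕ → ℕ} {s : Store} (hs : s.arr 2 = out)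
    (hne : ∃ Q : I.VertexPartition, I.IsCapacityPartition Q) (hc : d.Feas c)
    (hout : ∀ v < d.n, out v = if c v < d.u then c v else d.u + v)
    (hopt : ∀ Q : I.VertexPartition, I.IsCapacityPartition Q → 2 * I.value Q ≤ d.val c) :
    ∃ P : I.VertexPartition, I.IsOptimal P ∧ I.OutputIs s P := by
  classical
  let r : Setoid (Fin I.n) := Setoid.ker fun v : Fin I.n => out v
  let P : I.VertexPartition := Finpartition.ofSetoid r
  have hP : ∀ i j, j ∈ P.part i ↔ out i = out j := fun i j =>
    Finpartition.mem_part_ofSetoid_iff_rel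
  -- The output labels `u + v` differ from each other and from all labels below `u`, so every vertex
  -- with label `u` becomes a singleton.
  have hout' : ∀ i j : Fin I.n, out i = out j ↔ i = j ∨ (c i = c j ∧ c i < d.u) := fun i j => by
    rw [hout i (by rw [h.n]; exact i.2), hout j (by rw [h.n]; exact j.2)]
    by_cases hij : i = j
    · subst hij; simp
    · have := Fin.val_ne_of_ne hij
      split <;> split <;> simp only [hij, false_or] <;> omega
  have hcap : I.IsCapacityPartition P := fun S hS => by
    obtain ⟨i, hi⟩ := P.nonempty_of_mem_parts hS
    have hSi := P.part_eq_of_mem hS hi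
    rw [← hSi]
    by_cases hlt : c i < d.u
    · rw [← h.C]
      refine le_trans (card_le_card fun j hj => ?_) ((h.count_eq c (c i)).symm.le.trans (hc _ hlt))
      rw [hP, hout'] at hj
      rcases hj with rfl | hj
      · simp
      · simp [hj.1]
    -- Singletons are allowed because the coalition of `i` in `Q` is nonempty, which forces the
    -- capacity to be at least `1`.
    · obtain ⟨Q, hQ⟩ := hne
      have h1 : #(P.part i) ≤ #{i} := card_le_card fun j hj => by
        rw [hP, hout'] at hj
        rcases hj with rfl | hj
        · simp
        · exact absurd hj.2 hlt
      have h2 : 0 < #(Q.part i) := card_pos.2 ⟨i, Q.mem_part (mem_univ i)⟩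
      have h3 := hQ _ (Q.part_mem.2 (mem_univ i))
      rw [card_singleton] at h1
      omega
  have hval : 2 * I.value P = d.val c := by
    rw [I.two_mul_value, h.val_eq]
    refine sum_congr rfl fun i _ => sum_congr rfl fun j _ => ?_
    by_cases hij : i = j
    · subst hij; rw [I.weightEntry_of_not_adj I.G.irrefl]; simp
    · simp only [hP, hout', hij, false_or]
  refine ⟨P, ⟨hcap, fun Q hQ => ?_⟩, fun i j => ?_⟩
  · have := hopt Q hQ
    omega
  · rw [hs, ← hP, P.mem_part_iff_exists]
    exact ⟨fun ⟨S, h1, h2, h3⟩ => ⟨S, h1, h3, h2⟩, fun ⟨S, h1, h2, h3⟩ => ⟨S, h1, h3, h2⟩⟩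

end Describes

/-! ### Correctness on the actual input -/

namespace Code

variable (I : Instance)

open Classical in
theorem matching_input {s : Store} (hs : (matching.eval (offsets.eval I.input)) = s) :
    (∀ i : Fin I.n, s.arr aOffset i = I.n * i) ∧ s.reg rCover ≤ 2 * I.vc ∧
      (∀ v, s.arr aMark v = 0 ∨ s.arr aMark v = 1) ∧
      ∑ v ∈ range I.n, s.arr aMark v = s.reg rCover ∧
      ∀ i j : Fin I.n, I.G.Adj i j → s.arr aMark i = 1 ∨ s.arr aMark j = 1 := by
  have hoff : ∀ i : Fin I.n, (offsets.eval I.input).arr aOffset i = I.n * i := fun i =>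
    offsets_spec (s := I.input) rfl i.2
  have hadj : ∀ i < I.n, ∀ j < I.n, (offsets.eval I.input).arr aAdj
      ((offsets.eval I.input).arr aOffset i + j) = 1 ↔
        ∃ (hi : i < I.n) (hj : j < I.n), I.G.Adj ⟨i, hi⟩ ⟨j, hj⟩ := fun i hi j hj => by
    rw [hoff ⟨i, hi⟩, eval_arr (by decide)]
    change Instance.layout I.adjEntry (I.n * (⟨i, hi⟩ : Fin I.n) + (⟨j, hj⟩ : Fin I.n)) = 1 ↔ _
    rw [Instance.layout_apply, Instance.adjEntry]
    simp [hi, hj]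
  obtain ⟨h1, h2⟩ := matching_spec (s := offsets.eval I.input) (n := I.n)
    (eval_reg (by decide)) (eval_reg (by decide)) (fun v => by rw [eval_arr (by decide)]; rfl) hadj
    (by rintro i ⟨hi, _, h⟩; exact I.G.irrefl h)
  rw [hs] at h1 h2
  refine ⟨fun i => by rw [← hs, eval_arr (by decide), hoff], ?_, h1.mark, h1.sum,
    fun i j h => h2 i i.2 j j.2 ⟨i.2, j.2, h⟩⟩
  -- A minimum vertex cover contains at least half of the marked vertices, which gives `u ≤ 2 * vc`.
  obtain ⟨K, hK, hcov⟩ := I.G.vertexCoverNum_exists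
  have hcard : #K.toFinset = I.vc := by
    rw [Instance.vc, ← hK, Set.encard_eq_coe_toFinset_card]; simp
  have := h1.cover (K.toFinset.image Fin.val) (by
    rintro i hi j hj ⟨_, _, h⟩
    refine (hcov h).imp (fun h => ?_) (fun h => ?_)
    · exact mem_image.2 ⟨⟨i, hi⟩, by simpa using h, rfl⟩
    · exact mem_image.2 ⟨⟨j, hj⟩, by simpa using h, rfl⟩)
  refine this.trans (Nat.mul_le_mul_left _ ?_)
  calc (∑ v ∈ range I.n, if v ∈ K.toFinset.image Fin.val then s.arr aMark v else 0)
      ≤ ∑ v ∈ range I.n, if v ∈ K.toFinset.image Fin.val then 1 else 0 :=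
        sum_le_sum fun v _ => by
          split
          · rcases h1.mark v with h | h <;> omega
          · exact le_rfl
    _ = #{v ∈ range I.n | v ∈ K.toFinset.image Fin.val} := (card_filter _ _).symm
    _ ≤ #(K.toFinset.image Fin.val) := card_le_card fun v hv => (mem_filter.1 hv).2
    _ ≤ I.vc := card_image_le.trans hcard.le

theorem prelude_spec : ∃ d : Data, Env d (prelude.eval I.input) ∧ Describes d I := by
  set s := matching.eval (offsets.eval I.input) with hs
  obtain ⟨hoff, -, hmark, hsum, hcov⟩ := matching_input I hs.symm
  have hpre : prelude.eval I.input =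
      power.eval ((set rBase (.add (.reg rCover) (.const 1))).eval s) := rfl
  have hreg : ∀ y, y ∉ (set rBase (.add (.reg rCover) (.const 1)) ;; power).regs →
      (prelude.eval I.input).reg y = s.reg y := fun y hy => by
    rw [hpre]; exact eval_reg (p := set rBase (.add (.reg rCover) (.const 1)) ;; power) hy
  have harr : ∀ a, (prelude.eval I.input).arr a = s.arr a := fun a => by
    rw [hpre]
    exact eval_arr (p := set rBase (.add (.reg rCover) (.const 1)) ;; power)
      (by simp [power, multiply, arrs])
  have hn : s.reg rN = I.n := by rw [hs, eval_reg (by decide), eval_reg (by decide)]; rfl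
  have hC : s.reg rCap = I.capacity := by
    rw [hs, eval_reg (by decide), eval_reg (by decide)]; rfl
  have hb : ((set rBase (.add (.reg rCover) (.const 1))).eval s).reg rBase = s.reg rCover + 1 :=
    Store.setReg_same _ _ _
  have hW : ∀ i j : Fin I.n, s.arr aWeight (s.arr aOffset i + j) = I.weightEntry i j :=
    fun i j => by
      rw [hoff, hs, eval_arr (by decide), eval_arr (by decide)]
      exact Instance.layout_apply _ i j
  refine ⟨⟨I.n, I.capacity, s.reg rCover, fun i j => s.arr aWeight (s.arr aOffset i + j),
    s.arr aMark⟩, ⟨?_, ?_, ?_, ?_, ?_, ?_, ?_⟩, ⟨rfl, rfl, ⟨hmark, ?_, ?_⟩, hW, ?_, hcov⟩⟩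
  · rw [hreg _ (by decide), hn]
  · rw [hreg _ (by decide), hC]
  · rw [hreg _ (by decide)]
  · rw [hpre, eval_reg (by decide), hb]
  · rw [hpre, power_spec, hb]; rfl
  · intro i j; rw [harr, harr]
  · intro v; rw [harr]
  · intro i hi j hj
    exact (hW ⟨i, hi⟩ ⟨j, hj⟩).trans ((I.weightEntry_comm _ _).trans (hW ⟨j, hj⟩ ⟨i, hi⟩).symm)
  · intro i hi j hj mi mj
    refine (hW ⟨i, hi⟩ ⟨j, hj⟩).trans (I.weightEntry_of_not_adj fun h => ?_)
    rcases hcov _ _ h with h' | h'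
    · exact absurd (h'.symm.trans mi) one_ne_zero
    · exact absurd (h'.symm.trans mj) one_ne_zero
  · change (∑ w ∈ range I.n, if s.arr aMark w = 1 then 1 else 0) = s.reg rCover
    rw [← hsum]
    refine sum_congr rfl fun v _ => ?_
    rcases hmark v with h | h <;> simp [h]

/-- The right guess `k` depends on the competitor `Q`, but the search result does not; applying
`search_spec` once per `Q` shows that one result beats them all. -/
theorem solve_correct (hne : ∃ Q : I.VertexPartition, I.IsCapacityPartition Q) :
    ∃ P : I.VertexPartition, I.IsOptimal P ∧ I.OutputIs (solve.eval I.input) P := by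
  obtain ⟨d, hE, hd⟩ := prelude_spec I
  have hE' := hE.eval search (by decide) (by decide)
  have h0 : (prelude.eval I.input).reg rBest = 0 := eval_reg (by decide)
  have key : ∀ Q : I.VertexPartition, I.IsCapacityPartition Q →
      d.Feas ((search.eval (prelude.eval I.input)).arr aBest) ∧
        2 * I.value Q ≤ d.val ((search.eval (prelude.eval I.input)).arr aBest) := fun Q hQ => by
    obtain ⟨k, hk, hlt, hf, c, hc, hv⟩ := hd.exists_start Q hQ
    obtain ⟨h1, h2⟩ := search_spec hE hd.nice h0 (fun v hv hm => (hd.rank_lt_u hv hm).le) hk hlt hf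
    exact ⟨h1, hv.trans (h2 c hc)⟩
  obtain ⟨Q, hQ⟩ := hne
  exact hd.exists_optimal rfl ⟨Q, hQ⟩ (key Q hQ).1 (output_spec hE') fun Q hQ => (key Q hQ).2

end Code

/-! ### The time bound -/

/-- The number of codes is bounded in terms of the vertex cover number. -/
theorem codes_le {u k : ℕ} (h : u ≤ 2 * k) : (u + 1) ^ (u + 1) ≤ 27 * k ^ (9 * k) := by
  have h1 : (u + 1) ^ (u + 1) ≤ (2 * k + 1) ^ (2 * k + 1) :=
    (Nat.pow_le_pow_left (by omega) _).trans (Nat.pow_le_pow_right (by omega) (by omega))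
  refine h1.trans ?_
  rcases Nat.lt_or_ge k 2 with hk | hk
  -- For `k = 0` this uses `0 ^ 0 = 1`; for `k = 1` the bound `3 ^ 3 = 27` gives the constant.
  · interval_cases k <;> norm_num
  · have h2 : 2 * k + 1 ≤ k ^ 3 := by nlinarith [Nat.pow_le_pow_left hk 2]
    calc (2 * k + 1) ^ (2 * k + 1) ≤ (k ^ 3) ^ (2 * k + 1) := Nat.pow_le_pow_left h2 _
      _ = k ^ (3 * (2 * k + 1)) := (pow_mul _ _ _).symm
      _ ≤ k ^ (9 * k) := Nat.pow_le_pow_right (by omega) (by omega)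
      _ ≤ 27 * k ^ (9 * k) := Nat.le_mul_of_pos_left _ (by norm_num)

/-- Here `54 = 2 * 27` comes from `n + R + 1 ≤ 2 * R * (n + 1)`, and `9 * c` from raising `k ^ (9 *
k)` to the power `c`. Their combination serves as factor and as both exponents. -/
theorem time_le {c n k R t : ℕ} (hR : 1 ≤ R) (hR' : R ≤ 27 * k ^ (9 * k))
    (ht : t ≤ c * (n + R + 1) ^ c) :
    t ≤ (c * 54 ^ c + 9 * c) * k ^ ((c * 54 ^ c + 9 * c) * k) *
      (n + 1) ^ (c * 54 ^ c + 9 * c) := by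
  set C := c * 54 ^ c + 9 * c with hC
  have hcC : c ≤ C := by omega
  have h1 : n + R + 1 ≤ 54 * k ^ (9 * k) * (n + 1) := by nlinarith
  have h2 : (k ^ (9 * k)) ^ c ≤ k ^ (C * k) := by
    rw [← pow_mul]
    rcases Nat.eq_zero_or_pos k with rfl | hk
    · simp
    · refine Nat.pow_le_pow_right hk ?_
      calc 9 * k * c = 9 * c * k := by ring
        _ ≤ C * k := Nat.mul_le_mul_right _ (by omega)
  calc t ≤ c * (54 * k ^ (9 * k) * (n + 1)) ^ c :=
        ht.trans (Nat.mul_le_mul_left _ (Nat.pow_le_pow_left h1 _))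
    _ = c * 54 ^ c * (k ^ (9 * k)) ^ c * (n + 1) ^ c := by rw [mul_pow, mul_pow]; ring
    _ ≤ C * k ^ (C * k) * (n + 1) ^ C :=
        Nat.mul_le_mul (Nat.mul_le_mul (by omega) h2)
          (Nat.pow_le_pow_right (Nat.succ_pos _) hcC)

end CoalitionFormation

/-- Some program solves Weighted `𝒞`-Coalition Formation in `vc ^ O(vc) * n ^ O(1)` steps, where
`n` is the number of vertices and `vc` the vertex cover number of the input graph. (`n + 1` instead
of `n` only matters for the graph without vertices; `0 ^ 0 = 1`.) -/
theorem theorem1p3 :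
    ∃ (p : CoalitionFormation.Program) (c : ℕ),
      CoalitionFormation.SolvesInTime p
        (fun I => c * I.vc ^ (c * I.vc) * (I.n + 1) ^ c) := by
  obtain ⟨c, hc⟩ := CoalitionFormation.Code.bound_le CoalitionFormation.Code.solve
  refine ⟨CoalitionFormation.Code.solve.toProgram, c * 54 ^ c + 9 * c, fun I => ?_⟩
  obtain ⟨-, hu, -⟩ := CoalitionFormation.Code.matching_input I rfl
  -- The loop bound `M` is `n + (u + 1) ^ (u + 1)`.
  obtain ⟨t, ht, hr⟩ := CoalitionFormation.Code.solve_runs (s := I.input)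
    (Nat.le_add_right I.n _) (Nat.le_add_left _ I.n)
  exact ⟨t, _, hr, CoalitionFormation.time_le (Nat.one_le_pow _ _ (Nat.succ_pos _))
    (CoalitionFormation.codes_le hu) (ht.trans (hc _)), CoalitionFormation.Code.solve_correct I⟩
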